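/- **Setting.** Let $F$ be a separable real Hilbert space with its Borel $\sigma$-algebra, $P$ a probability measure on a measurable space $Z$, $n\ge 1$, and $S=(z_1,\dots,z_n)\sim P^n$ with empirical distribution $P_S=\frac1n\sum_i\delta_{z_i}$. Let $\ell:F\times Z\to\mathbb R$ be jointly measurable, Fréchet differentiable in $f\in F$ for every $z$, with $\ell(f,\cdot)$ $P$-integrable for every $f$ and with Fréchet differentiable risk $r(f)=\int \ell(f,z)\,P(dz)$. Let $\Delta(f,z)=r(f)-\ell(f,z)$, and let $\nabla\Delta$ be its gradient in $f$. Let $\Sigma$ assign to each $f\in F$ a symmetric nonnegative linear operator $\Sigma(f)$ on $F$, measurably in $f$; no continuity or invertibility is assumed. Put $|v|_{\mathcal T_f}=\sqrt{\langle v,\Sigma(f)^{-1}v\rangle}$ for $v\in\Sigma(f)F$ and $|v|_{\mathcal T_f}=\infty$ otherwise. Assume that $\Delta$ is $L_\Delta$-Lipschitz, $0\le L_\Delta<\infty$, with respect to $\Sigma$: $$\lim_{\rho\downarrow0}\ \sup_{|g-f|_{\mathcal T_f}\le\rho}\frac{|\Delta(g,z)-\Delta(f,z)|}{\rho}\le L_\Delta\qquad\text{for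 all } f\in F,\ z\in Z.$$ A *posterior flow* $\xi$ consists of a probability measure $Q_0$ on $F$, a probability space $(\Omega_0,P_0)$ and a random time-dependent vector field $\xi_t(f,\omega_0)$ on $F$, $t\in[0,\infty)$, such that for $Q_0\otimes P_0$-almost every $(f_0,\omega_0)$ there is an everywhere differentiable solution of $\frac{d}{dt}f_t=\xi_t(f_t,\omega_0)$, $t\ge0$, that starts at $f_0$, where $f_t$ is a random variable for each $t$; $Q_t^\xi$ denotes the law of $f_t$. It is assumed that $\xi_t(f_t,\omega_0)$ is integrable for each $t$; the *mean flow* is $\mu_t(f)=\mathbb E[\xi_t(f_t,\omega_0)\mid f_t=f]$. Put $$D_t(\xi;S)=\int P_S\Delta(f)\,Q_t^\xi(df),\quad W_t(\xi)=\Big(\int|\mu_t(f)|_{\mathcal T_f}^2\,Q_t^\xi(df)\Big)^{1/2},\quad V_t(\xi;S)=\Big(\int \tfrac{P+P_S}{2}\langle\mu_t(f),\nabla\Delta(f,\cdot)\rangle^2\,Q^\xi_t(df)\Big)^{1/2}.$$ **Theorem.** Fix a probability measure $U$ on $F$ (the prior) and $\delta\in(0,1)$. Then with probability at least $1-\delta$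 over $S\sim P^n$ the following holds simultaneously for all posterior flows $\xi$ and all times $t\ge0$ such that $P_S\Delta$ is $Q_t^\xi$-integrable and the energy $\mathbb E\,|\xi_s(f_s,\omega_0)|_{\mathcal T_{f_s}}^2$ is bounded for $s\ge0$ in a neighbourhood of $t$: the map $s\mapsto D_s(\xi;S)$ is differentiable at $t$ (from the right if $t=0$), and $$\frac{d}{dt}D_t(\xi;S)\ \le\ 2V_t(\xi;S)\sqrt{\frac{\mathrm{KL}(Q_t^\xi,U)+\ln\frac1\delta+c(n)}{n}}+\frac{2L_\Delta W_t(\xi)}{\sqrt n},\qquad c(n)=\ln\!\big(e+\ln^2(2n^2)\big),$$ where the right-hand side takes values in $[0,\infty]$ and $0\cdot\infty=0$. -/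

import Mathlib

open MeasureTheory Set Filter Topology
open scoped NNReal ENNReal RealInnerProductSpace

namespace Transport

noncomputable section

/-- The local norm `|v|_𝒯 = √⟪v, A⁻¹ v⟫` given by an inverse metric `A` (a symmetric nonnegative
operator): it is `√⟪v, u⟫` for any `u` with `A u = v` (the value does not depend on `u`),
and `∞` if `v` is not in the range of `A`. -/
def localNorm {F : Type*} [NormedAddCommGroup F] [InnerProductSpace ℝ F]
    (A : F →L[ℝ] F) (v : F) : ℝ≥0∞ :=
  ⨅ (u : F) (_ : A u = v), ENNReal.ofReal (√⟪v, u⟫)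

/-- The risk `r(f) = P ℓ(f)`. -/
def risk {F Z : Type*} [MeasurableSpace Z] (P : Measure Z) (ℓ : F → Z → ℝ) (f : F) : ℝ :=
  ∫ z, ℓ f z ∂P

/-- The deviation function `Δ(f, z) = r(f) - ℓ(f, z)`. -/
def deviation {F Z : Type*} [MeasurableSpace Z] (P : Measure Z) (ℓ : F → Z → ℝ)
    (f : F) (z : Z) : ℝ :=
  risk P ℓ f - ℓ f z

/-- The empirical distribution `P_S = (1/n) ∑ᵢ δ_{zᵢ}` of a sample `S = (z₁, …, zₙ)`. -/
def empirical {Z : Type*} [MeasurableSpace Z] {n : ℕ} (S : Fin n → Z) : Measure Z :=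
  (n : ℝ≥0∞)⁻¹ • ∑ i, Measure.dirac (S i)

/-- A function `Δ` of `(f, z)` is `L`-Lipschitz in `f` with respect to the inverse metric field `A`:
`lim_{ρ → 0} sup_{|g - f|_{𝒯_f} ≤ ρ} |Δ(g, z) - Δ(f, z)| / ρ ≤ L` for all `f` and `z`. -/
def IsLipschitz {F Z : Type*} [NormedAddCommGroup F] [InnerProductSpace ℝ F]
    (A : F → F →L[ℝ] F) (Δ : F → Z → ℝ) (L : ℝ≥0) : Prop :=
  ∀ f z, limsup (fun ρ : ℝ =>
    ⨆ (g : F) (_ : localNorm (A f) (g - f) ≤ ENNReal.ofReal ρ),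
      ENNReal.ofReal |Δ g z - Δ f z| / ENNReal.ofReal ρ) (𝓝[>] 0) ≤ L

/-- A posterior flow: an initial posterior `Q₀`, a random time-dependent vector field
`ξ_t(f, ω₀)` with `ω₀ ∼ P₀` independent of `f₀ ∼ Q₀`, and a solution `f_t` (`t ≥ 0`) of
`d f_t = ξ_t(f_t, ω₀) dt` that starts at `f₀` and exists almost surely. -/
structure PosteriorFlow (F Ω₀ : Type*) [NormedAddCommGroup F] [InnerProductSpace ℝ F]
    [MeasurableSpace F] [MeasurableSpace Ω₀] where
  /-- the initial posterior -/
  Q₀ : Measure F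
  /-- the source of randomness of the transportation -/
  P₀ : Measure Ω₀
  /-- the random vector field -/
  field : ℝ → F → Ω₀ → F
  /-- the solution `f_t` as a function of `(f₀, ω₀)` -/
  sol : ℝ → F × Ω₀ → F
  prob_Q₀ : IsProbabilityMeasure Q₀
  prob_P₀ : IsProbabilityMeasure P₀
  measurable_sol : ∀ t, 0 ≤ t → Measurable (sol t)
  isSolution : ∀ᵐ x ∂(Q₀.prod P₀), sol 0 x = x.1 ∧
    ∀ t, 0 ≤ t → HasDerivWithinAt (fun s => sol s x) (field t (sol t x) x.2) (Ici 0) t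

namespace PosteriorFlow

variable {F Ω₀ : Type*} [NormedAddCommGroup F] [InnerProductSpace ℝ F]
  [MeasurableSpace F] [MeasurableSpace Ω₀]

/-- The joint law `Q₀ ⊗ P₀` of `(f₀, ω₀)`. -/
def base (ξ : PosteriorFlow F Ω₀) : Measure (F × Ω₀) := ξ.Q₀.prod ξ.P₀

/-- The velocity `ξ_t(f_t, ω₀)` along the solution. -/
def velocity (ξ : PosteriorFlow F Ω₀) (t : ℝ) (x : F × Ω₀) : F := ξ.field t (ξ.sol t x) x.2

/-- The snapshot distribution `Q_t^ξ`, the law of `f_t`. -/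
def law (ξ : PosteriorFlow F Ω₀) (t : ℝ) : Measure F := ξ.base.map (ξ.sol t)

/-- `μ` is the mean posterior flow of `ξ`: `μ_t(f) = 𝔼[ξ_t(f, ω₀) | f_t = f]`. -/
def IsMeanFlow [CompleteSpace F] (ξ : PosteriorFlow F Ω₀) (μ : ℝ → F → F) : Prop :=
  ∀ t, 0 ≤ t → Measurable (μ t) ∧ Integrable (ξ.velocity t) ξ.base ∧
    ξ.base[ξ.velocity t | MeasurableSpace.comap (ξ.sol t) inferInstance]
      =ᵐ[ξ.base] fun x => μ t (ξ.sol t x)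

/-- The kinetic energy `𝔼 |ξ_s(f_s, ω₀)|²_{𝒯_{f_s}}` is bounded for `s ≥ 0` near `t`. -/
def EnergyBoundedNear (ξ : PosteriorFlow F Ω₀) (A : F → F →L[ℝ] F) (t : ℝ) : Prop :=
  ∃ C : ℝ≥0, ∀ᶠ s in 𝓝[Ici 0] t,
    ∫⁻ x, localNorm (A (ξ.sol s x)) (ξ.velocity s x) ^ 2 ∂ξ.base ≤ C

/-- The deviation `D_t(ξ; S) = Q_t^ξ P_S Δ`. -/
def dev {Z : Type*} [MeasurableSpace Z] {n : ℕ} (ξ : PosteriorFlow F Ω₀) (Δ : F → Z → ℝ)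
    (S : Fin n → Z) (t : ℝ) : ℝ :=
  ∫ f, ∫ z, Δ f z ∂(empirical S) ∂(ξ.law t)

end PosteriorFlow

/-- The Wasserstein velocity `W = √(𝔼_{f ∼ Q} |μ(f)|²_{𝒯_f})` of a vector field `μ` under `Q`. -/
def wassersteinVelocity {F : Type*} [NormedAddCommGroup F] [InnerProductSpace ℝ F]
    [MeasurableSpace F] (A : F → F →L[ℝ] F) (Q : Measure F) (μ : F → F) : ℝ≥0∞ :=
  (∫⁻ f, localNorm (A f) (μ f) ^ 2 ∂Q) ^ (1 / 2 : ℝ)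

/-- The deviation-based velocity `V = √(Q ((P + P_S) / 2) ⟪μ, ∇Δ⟫²)`, where the gradient is taken
with respect to `f`. -/
def deviationVelocity {F Z : Type*} [NormedAddCommGroup F] [InnerProductSpace ℝ F]
    [CompleteSpace F] [MeasurableSpace F] [MeasurableSpace Z] {n : ℕ} (P : Measure Z)
    (Δ : F → Z → ℝ) (S : Fin n → Z) (Q : Measure F) (μ : F → F) : ℝ≥0∞ :=
  (∫⁻ f, ∫⁻ z, ENNReal.ofReal (⟪μ f, gradient (fun g => Δ g z) f⟫ ^ 2)
    ∂((2 : ℝ≥0∞)⁻¹ • (P + empirical S)) ∂Q) ^ (1 / 2 : ℝ)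

/-- The complexity `H_δ(Q, U) = KL(Q, U) + ln (1 / δ)`. -/
def complexity {F : Type*} [MeasurableSpace F] (δ : ℝ) (Q U : Measure F) : ℝ≥0∞ :=
  InformationTheory.klDiv Q U + ENNReal.ofReal (Real.log (1 / δ))

/-- `c(n) = ln (e + ln² (2 n²))`. -/
def logFactor (n : ℕ) : ℝ := Real.log (Real.exp 1 + Real.log (2 * (n : ℝ) ^ 2) ^ 2)

end

end Transport

/-!
The deviation `Δ(f, ·)` is centred under `P` at each `f`, so its derivative along a tangent vector `v`
should be a centred function of `z`, and `d/dt D_t` should be the posterior average of the empirical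
mean of `⟪μ_t(f), ∇Δ(f, zᵢ)⟫`. The proof bounds this empirical process of *tangent vectors* uniformly
in the direction and in the posterior.

**Tangent directions.** The Lipschitz condition says that `Y = ∇Δ(f, z)` satisfies
`Y(A u)² ≤ L² ⟪u, A u⟫` (`IsLipschitz.sq_fderiv_le`). For one direction `v`, the inequality
`exp (x - x² / 2) ≤ 1 + x + x² / 2` shows that the exponential of `logWeight P Y S v` has expectation
at most `1`. To make this uniform in `v`, the directions are averaged over a Gaussian measure whose
covariance is `A` rescaled by `1 / λ`. By the Cameron–Martin formula, the average exceeds the value at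
any given `v`, up to the penalty `λ / 2` times the energy of `v` and the trace of the quadratic part,
which is at most `n L² / λ` in every dimension (`exp_le_lintegral_stdGaussian`). So finite-dimensional
Gaussians suffice: monotone convergence passes to a sequence of directions
(`lintegral_iSup_exp_logWeight_le`), and density to all `v` of finite dual energy, that is, to the
range of `A ^ (1 / 2)` (`exp_logWeight_le_iSup_denseSeq`). The dual energy is at most the squared local
norm and, unlike the latter, visibly measurable.

**Change of measure.** Integration over the prior, Markov's inequality and the Donsker–Varadhan
inequality give one event on which the averaged log-weight is controlled for all posteriors, all
vector fields and a finite grid of values of `λ` (`exists_event_integral_logWeight_le`). The best scale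
of `v` and the best `λ` of the geometric grid of `1 + log₄ n` points turn this into the claimed bound
(`le_of_forall_grid_le`); the size of the grid is what `c(n)` pays for.

**The flow.** The boundedness of the kinetic energy near `t` gives second moments for the difference
quotients of `s ↦ Ψ(f_s)`, hence uniform integrability, which justifies differentiation under the
expectation (`tendsto_integral_slope`). The tower property then replaces the velocity by the mean flow.
The same argument, applied under the product of the law of the flow and `P`, shows that
`⟪μ_t(f), ∇Δ(f, ·)⟫` is centred under `P` for almost every `f`
(`PosteriorFlow.ae_integral_fderiv_meanFlow_eq_zero`); at an individual `f`, differentiation and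
integration in `z` need not commute.

When `L = 0` the deviation is stationary along every flow, and the event is the whole space.
-/

namespace Transport

/-! ### Gaussian averages -/

theorem ofReal_integral_le_lintegral {α : Type*} [MeasurableSpace α] {m : Measure α} {f : α → ℝ}
    (hf : Integrable f m) : ENNReal.ofReal (∫ x, f x ∂m) ≤ ∫⁻ x, ENNReal.ofReal (f x) ∂m := by
  have h : ∀ x, ENNReal.ofReal (f x) = ENNReal.ofReal (max (f x) 0) := fun x => by
    rw [ENNReal.ofReal_max, ENNReal.ofReal_zero, max_eq_left (zero_le)]
  simp_rw [h]
  rw [← ofReal_integral_eq_lintegral_ofReal hf.pos_part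
    (Eventually.of_forall fun _ => le_max_right _ _)]
  exact ENNReal.ofReal_le_ofReal (integral_mono hf hf.pos_part fun _ => le_max_left _ _)

section Gaussian

open ProbabilityTheory

variable {H : Type*} [NormedAddCommGroup H] [InnerProductSpace ℝ H] [FiniteDimensional ℝ H]
  [MeasurableSpace H] [BorelSpace H]

theorem stdGaussian_eq_withDensity :
    stdGaussian H = volume.withDensity (fun x : H => ENNReal.ofReal
      (Real.exp (-(1 / 2) * ‖x‖ ^ 2) / ∫ y : H, Real.exp (-(1 / 2) * ‖y‖ ^ 2))) := by
  set c : ℝ := ∫ y : H, Real.exp (-(1 / 2) * ‖y‖ ^ 2) with hc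
  have hcval : c = (Real.pi / (1 / 2)) ^ ((Module.finrank ℝ H : ℝ) / 2) :=
    GaussianFourier.integral_rexp_neg_mul_sq_norm (by norm_num)
  have hcpos : 0 < c := by rw [hcval]; positivity
  have hint : Integrable (fun y : H => Real.exp (-(1 / 2) * ‖y‖ ^ 2)) := by
    by_contra h
    exact hcpos.ne' (integral_undef h)
  have hmeas : Measurable fun x : H => ENNReal.ofReal (Real.exp (-(1 / 2) * ‖x‖ ^ 2) / c) := by
    fun_prop
  have hfin : IsFiniteMeasure (volume.withDensity (fun x : H => ENNReal.ofReal
      (Real.exp (-(1 / 2) * ‖x‖ ^ 2) / c))) :=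
    isFiniteMeasure_withDensity_ofReal (hint.div_const c).2
  refine Measure.ext_of_charFun ?_
  ext t
  rw [charFun_stdGaussian, charFun_apply, integral_withDensity_eq_integral_toReal_smul hmeas
    (Eventually.of_forall fun _ => ENNReal.ofReal_lt_top)]
  have hpt : ∀ x : H, (ENNReal.ofReal (Real.exp (-(1 / 2) * ‖x‖ ^ 2) / c)).toReal •
      Complex.exp (⟪x, t⟫ * Complex.I)
      = (c : ℂ)⁻¹ * Complex.exp (-(1 / 2 : ℂ) * ‖x‖ ^ 2 + Complex.I * ⟪t, x⟫) := by
    intro x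
    rw [ENNReal.toReal_ofReal (by positivity), Complex.exp_add, Complex.real_smul,
      real_inner_comm]
    push_cast
    rw [mul_comm Complex.I]
    ring
  simp_rw [hpt]
  rw [integral_const_mul, GaussianFourier.integral_cexp_neg_mul_sq_norm_add (by norm_num)]
  have hcc : (c : ℂ) = (Real.pi / (1 / 2) : ℂ) ^ ((Module.finrank ℝ H : ℂ) / 2) := by
    rw [hcval, Complex.ofReal_cpow (by positivity)]
    push_cast
    rfl
  rw [← hcc, ← mul_assoc, inv_mul_cancel₀ (by exact_mod_cast hcpos.ne'), one_mul, Complex.I_sq]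
  congr 1
  ring

/-- Cameron–Martin formula for the standard Gaussian. -/
theorem lintegral_stdGaussian_shift (u : H) {G : H → ℝ≥0∞} (hG : Measurable G) :
    ∫⁻ x, G x ∂(stdGaussian H) =
      ∫⁻ x, G (x + u) * ENNReal.ofReal (Real.exp (-⟪x, u⟫ - ‖u‖ ^ 2 / 2)) ∂(stdGaussian H) := by
  rw [stdGaussian_eq_withDensity]
  set c : ℝ := ∫ y : H, Real.exp (-(1 / 2) * ‖y‖ ^ 2) with hc
  have hc0 : 0 ≤ c := integral_nonneg fun _ => (Real.exp_pos _).le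
  have hmeas : Measurable fun x : H => ENNReal.ofReal (Real.exp (-(1 / 2) * ‖x‖ ^ 2) / c) := by
    fun_prop
  rw [lintegral_withDensity_eq_lintegral_mul _ hmeas hG,
    lintegral_withDensity_eq_lintegral_mul _ hmeas (by fun_prop),
    ← lintegral_add_right_eq_self _ u]
  refine lintegral_congr fun x => ?_
  simp only [Pi.mul_apply]
  rw [mul_comm (G (x + u)), ← mul_assoc, ← ENNReal.ofReal_mul (by positivity), div_mul_eq_mul_div,
    ← Real.exp_add]
  congr 4
  rw [norm_add_sq_real]
  ring

theorem integral_sq_dual_stdGaussian (y : H →L[ℝ] ℝ) :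
    Integrable (fun x => y x ^ 2) (stdGaussian H) ∧ ∫ x, y x ^ 2 ∂(stdGaussian H) = ‖y‖ ^ 2 := by
  have h2 : MemLp y 2 (stdGaussian H) := y.comp_memLp' IsGaussian.memLp_two_id
  refine ⟨h2.integrable_sq, ?_⟩
  rw [← variance_dual_stdGaussian, variance_of_integral_eq_zero h2.1.aemeasurable]
  exact integral_strongDual_stdGaussian y

/-- Averaging over a Gaussian direction dominates, up to the trace term `l² ν(Z) / 2`, the value of
`exp (a - ½ ∫ Y² dν)` at any single point `u`, penalised by `‖u‖² / 2`. The bound does not see the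
dimension of `H`. -/
theorem exp_le_lintegral_stdGaussian {Z : Type*} [MeasurableSpace Z] (ν : Measure Z)
    [IsFiniteMeasure ν] (Y : Z → H →L[ℝ] ℝ) (hY : ∀ v, Measurable fun z => Y z v) (l : ℝ)
    (hl : ∀ z, ‖Y z‖ ≤ l) (a : H →L[ℝ] ℝ) (u : H) :
    ENNReal.ofReal (Real.exp (a u - (∫ z, Y z u ^ 2 ∂ν) / 2 - ‖u‖ ^ 2 / 2 - l ^ 2 * ν.real univ / 2))
      ≤ ∫⁻ x, ENNReal.ofReal (Real.exp (a x - (∫ z, Y z x ^ 2 ∂ν) / 2)) ∂(stdGaussian H) := by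
  have hYj : Measurable fun p : H × Z => Y p.2 p.1 :=
    measurable_uncurry_of_continuous_of_measurable (u := fun (x : H) (z : Z) => Y z x)
      (fun z => (Y z).continuous) hY
  have hYb : ∀ z x, |Y z x| ≤ l * ‖x‖ := fun z x =>
    ((Y z).le_opNorm x).trans (by gcongr; exact hl z)
  have hYint : ∀ x y, Integrable (fun z => Y z x * Y z y) ν := fun x y => by
    refine Integrable.of_bound ((hY x).mul (hY y)).aestronglyMeasurable ((l * ‖x‖) * (l * ‖y‖))
      (Eventually.of_forall fun z => ?_)
    rw [norm_mul]
    exact mul_le_mul (hYb z x) (hYb z y) (norm_nonneg _) ((abs_nonneg _).trans (hYb z x))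
  set q : H → ℝ := fun x => ∫ z, Y z x ^ 2 ∂ν with hq
  have hqm : Measurable q :=
    ((hYj.pow_const 2).stronglyMeasurable.integral_prod_right (ν := ν)).measurable
  -- the polarisation of `q`
  have hqadd : ∀ x, q (x + u) = q x + 2 * ∫ z, Y z u * Y z x ∂ν + q u := by
    intro x
    have : ∀ z, Y z (x + u) ^ 2 = Y z x * Y z x + 2 * (Y z u * Y z x) + Y z u * Y z u := fun z => by
      rw [map_add]; ring
    simp only [hq, this]
    rw [integral_add (f := fun z => Y z x * Y z x + 2 * (Y z u * Y z x))
        ((hYint x x).add ((hYint u x).const_mul 2)) (hYint u u),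
      integral_add (hYint x x) ((hYint u x).const_mul 2), integral_const_mul]
    simp only [sq]
  let b₀ : H →ₗ[ℝ] ℝ :=
    { toFun := fun x => ∫ z, Y z u * Y z x ∂ν
      map_add' := fun x y => by
        rw [← integral_add (hYint u x) (hYint u y)]
        exact integral_congr_ae (Eventually.of_forall fun z => by simp [mul_add])
      map_smul' := fun c x => by
        rw [RingHom.id_apply, smul_eq_mul, ← integral_const_mul]
        exact integral_congr_ae (Eventually.of_forall fun z => by simp [mul_left_comm]) }
  let b : H →L[ℝ] ℝ := a - LinearMap.toContinuousLinearMap b₀ - innerSL ℝ u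
  have hbx : ∀ x, b x = a x - (∫ z, Y z u * Y z x ∂ν) - ⟪x, u⟫ := fun x => by
    simp [b, b₀, real_inner_comm]
  -- the Gaussian average of `q` is at most its trace
  have hprod : Integrable (fun p : H × Z => Y p.2 p.1 ^ 2) ((stdGaussian H).prod ν) := by
    have hn : Integrable (fun p : H × Z => l ^ 2 * ‖p.1‖ ^ 2) ((stdGaussian H).prod ν) := by
      have h2 : MemLp (id : H → H) 2 (stdGaussian H) := IsGaussian.memLp_two_id
      exact ((h2.integrable_norm_pow (by norm_num)).comp_fst ν).const_mul _
    refine hn.mono' (hYj.pow_const 2).aestronglyMeasurable (Eventually.of_forall fun p => ?_)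
    rw [Real.norm_eq_abs, abs_pow, ← mul_pow]
    exact pow_le_pow_left₀ (abs_nonneg _) (hYb _ _) 2
  have hqint : Integrable q (stdGaussian H) := hprod.integral_prod_left
  have hqle : ∫ x, q x ∂(stdGaussian H) ≤ l ^ 2 * ν.real univ := by
    rw [hq, integral_integral_swap hprod]
    simp_rw [(integral_sq_dual_stdGaussian _).2]
    calc ∫ z, ‖Y z‖ ^ 2 ∂ν ≤ ∫ _, l ^ 2 ∂ν := by
          refine integral_mono_of_nonneg (Eventually.of_forall fun _ => by positivity)
            (integrable_const _) (Eventually.of_forall fun z => ?_)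
          exact pow_le_pow_left₀ (norm_nonneg _) (hl z) 2
      _ = l ^ 2 * ν.real univ := by rw [integral_const, smul_eq_mul, mul_comm]
  have hbint : Integrable b (stdGaussian H) := b.integrable_comp IsGaussian.integrable_id
  have hb0 : ∫ x, b x ∂(stdGaussian H) = 0 := integral_strongDual_stdGaussian b
  have hGm : Measurable fun x => ENNReal.ofReal (Real.exp (a x - q x / 2)) := by fun_prop
  rw [lintegral_stdGaussian_shift u hGm]
  set c : ℝ := l ^ 2 * ν.real univ / 2 with hc
  set k : ℝ := a u - q u / 2 - ‖u‖ ^ 2 / 2 - c with hk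
  -- `1 + t ≤ exp t` in place of Jensen's inequality
  have hlow : ∀ x, ENNReal.ofReal (Real.exp k * (1 + b x - q x / 2 + c)) ≤
      ENNReal.ofReal (Real.exp (a (x + u) - q (x + u) / 2)) *
        ENNReal.ofReal (Real.exp (-⟪x, u⟫ - ‖u‖ ^ 2 / 2)) := by
    intro x
    rw [← ENNReal.ofReal_mul (Real.exp_pos _).le, ← Real.exp_add]
    refine ENNReal.ofReal_le_ofReal ?_
    have : a (x + u) - q (x + u) / 2 + (-⟪x, u⟫ - ‖u‖ ^ 2 / 2) = k + (b x - q x / 2 + c) := by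
      rw [hqadd, map_add, hbx, hk]; ring
    rw [this, Real.exp_add]
    gcongr
    linarith [Real.add_one_le_exp (b x - q x / 2 + c)]
  have hint : Integrable (fun x => Real.exp k * (1 + b x - q x / 2 + c)) (stdGaussian H) :=
    ((((integrable_const 1).add hbint).sub (hqint.div_const 2)).add (integrable_const c)).const_mul _
  refine le_trans ?_ ((ofReal_integral_le_lintegral hint).trans (lintegral_mono hlow))
  refine ENNReal.ofReal_le_ofReal ?_
  have hval : ∫ x, Real.exp k * (1 + b x - q x / 2 + c) ∂(stdGaussian H)
      = Real.exp k * (1 - (∫ x, q x ∂(stdGaussian H)) / 2 + c) := by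
    rw [integral_const_mul, integral_add (f := fun x => 1 + b x - q x / 2)
      (((integrable_const 1).add hbint).sub (hqint.div_const 2)) (integrable_const c),
      integral_sub (f := fun x => 1 + b x) ((integrable_const 1).add hbint) (hqint.div_const 2),
      integral_add (integrable_const 1) hbint, integral_div, hb0]
    simp
  rw [hval]
  have : 1 ≤ 1 - (∫ x, q x ∂(stdGaussian H)) / 2 + c := by rw [hc]; linarith
  nlinarith [Real.exp_pos k]

end Gaussian

/-! ### Exponential moments -/

section Exponential

theorem exp_sub_half_sq_le (x : ℝ) : Real.exp (x - x ^ 2 / 2) ≤ 1 + x + x ^ 2 / 2 := by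
  have h1 : 0 < 1 + x + x ^ 2 / 2 := by nlinarith [sq_nonneg (x + 1)]
  have h2 := Real.add_one_le_exp (x ^ 2 / 2 - x)
  have h3 : Real.exp (x - x ^ 2 / 2) * Real.exp (x ^ 2 / 2 - x) = 1 := by
    rw [← Real.exp_add]; simp
  have h4 := Real.exp_pos (x - x ^ 2 / 2)
  -- `(1 - x + x² / 2) (1 + x + x² / 2) = 1 + x⁴ / 4`
  have h5 : 1 ≤ (x ^ 2 / 2 - x + 1) * (1 + x + x ^ 2 / 2) := by nlinarith [sq_nonneg (x ^ 2)]
  have h6 : 1 ≤ Real.exp (x ^ 2 / 2 - x) * (1 + x + x ^ 2 / 2) :=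
    h5.trans (mul_le_mul_of_nonneg_right h2 h1.le)
  calc Real.exp (x - x ^ 2 / 2) ≤ Real.exp (x - x ^ 2 / 2) *
        (Real.exp (x ^ 2 / 2 - x) * (1 + x + x ^ 2 / 2)) := le_mul_of_one_le_right h4.le h6
    _ = 1 + x + x ^ 2 / 2 := by rw [← mul_assoc, h3, one_mul]

variable {Z : Type*} [MeasurableSpace Z] (P : Measure Z) [IsProbabilityMeasure P]

/-- Self-normalised exponential inequality. The bound `K` on `X` only serves integrability. -/
theorem lintegral_exp_selfNormalized_le (n : ℕ) {X : Z → ℝ} (hX : Measurable X) {K : ℝ}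
    (hK : ∀ z, |X z| ≤ K) :
    ∫⁻ S : Fin n → Z, ENNReal.ofReal (Real.exp (∑ i, (X (S i) - X (S i) ^ 2 / 2)
      - n * (∫ z, X z ∂P + (∫ z, X z ^ 2 ∂P) / 2))) ∂(Measure.pi fun _ => P) ≤ 1 := by
  have hXint : Integrable X P := Integrable.of_bound hX.aestronglyMeasurable K (ae_of_all _ hK)
  have hX2 : Integrable (fun z => X z ^ 2) P := by
    refine Integrable.of_bound (hX.pow_const 2).aestronglyMeasurable (K ^ 2) (ae_of_all _ fun z => ?_)
    rw [Real.norm_eq_abs, abs_pow]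
    exact pow_le_pow_left₀ (abs_nonneg _) (hK z) 2
  set c : ℝ := ∫ z, X z ∂P + (∫ z, X z ^ 2 ∂P) / 2 with hc
  set g : Z → ℝ := fun z => Real.exp (X z - X z ^ 2 / 2 - c) with hg
  have hgle : ∀ z, g z ≤ Real.exp (-c) * (1 + X z + X z ^ 2 / 2) := fun z => by
    rw [hg]
    simp only
    rw [sub_eq_neg_add _ c, Real.exp_add]
    gcongr
    exact exp_sub_half_sq_le _
  have hdom : Integrable (fun z => Real.exp (-c) * (1 + X z + X z ^ 2 / 2)) P :=
    (((integrable_const 1).add hXint).add (hX2.div_const 2)).const_mul _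
  have hgint : Integrable g P := by
    refine hdom.mono' (by fun_prop) (ae_of_all _ fun z => ?_)
    rw [Real.norm_of_nonneg (Real.exp_pos _).le]
    exact hgle z
  have hg1 : ∫ z, g z ∂P ≤ 1 := by
    calc ∫ z, g z ∂P ≤ ∫ z, Real.exp (-c) * (1 + X z + X z ^ 2 / 2) ∂P :=
          integral_mono hgint hdom hgle
      _ = Real.exp (-c) * (1 + c) := by
          rw [integral_const_mul, integral_add (f := fun z => 1 + X z)
            ((integrable_const 1).add hXint) (hX2.div_const 2),
            integral_add (integrable_const 1) hXint, integral_div, hc]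
          simp [add_assoc]
      _ ≤ Real.exp (-c) * Real.exp c := by gcongr; linarith [Real.add_one_le_exp c]
      _ = 1 := by rw [← Real.exp_add]; simp
  have hprod : ∀ S : Fin n → Z, Real.exp (∑ i, (X (S i) - X (S i) ^ 2 / 2) - n * c)
      = ∏ i, g (S i) := fun S => by
    rw [hg, ← Real.exp_sum, Finset.sum_sub_distrib (f := fun i => X (S i) - X (S i) ^ 2 / 2)]
    simp
  simp_rw [hprod]
  rw [← ofReal_integral_eq_lintegral_ofReal (Integrable.fintype_prod fun _ => hgint)
    (ae_of_all _ fun S => Finset.prod_nonneg fun i _ => (Real.exp_pos _).le),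
    integral_fintype_prod_eq_pow]
  exact ENNReal.ofReal_le_one.2
    (pow_le_one₀ (integral_nonneg fun _ => (Real.exp_pos _).le) hg1)

end Exponential

/-! ### Positive operators -/

section Gram

variable {F : Type*} [NormedAddCommGroup F] [InnerProductSpace ℝ F]

theorem inner_map_symm {A : F →L[ℝ] F} (hA : A.IsPositive) (u v : F) : ⟪u, A v⟫ = ⟪v, A u⟫ := by
  rw [real_inner_comm]
  exact hA.1 v u

theorem inner_map_nonneg {A : F →L[ℝ] F} (hA : A.IsPositive) (u : F) : 0 ≤ ⟪u, A u⟫ :=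
  hA.inner_nonneg_right u

theorem map_eq_zero_of_inner_eq_zero {A : F →L[ℝ] F} (hA : A.IsPositive) {v : F}
    (hv : ⟪v, A v⟫ = 0) : A v = 0 := by
  have h : ∀ t : ℝ, 0 ≤ 2 * t * ⟪A v, A v⟫ + t ^ 2 * ⟪A v, A (A v)⟫ := fun t => by
    have := inner_map_nonneg hA (v + t • A v)
    simp only [map_add, map_smul, inner_add_left, inner_add_right, inner_smul_left,
      inner_smul_right, hv, inner_map_symm hA v (A v), RCLike.conj_to_real] at this
    linarith
  have hb := inner_map_nonneg hA (A v)
  rw [← inner_self_eq_zero (𝕜 := ℝ)]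
  refine le_antisymm ?_ real_inner_self_nonneg
  set a := ⟪A v, A v⟫
  set b := ⟪A v, A (A v)⟫
  have h1 := h (-a / (b + 1))
  have hpos : 0 < b + 1 := by linarith
  have : 2 * (-a / (b + 1)) * a + (-a / (b + 1)) ^ 2 * b = -(a ^ 2 * (b + 2)) / (b + 1) ^ 2 := by
    field_simp
    ring
  rw [this] at h1
  have h2 : 0 ≤ -(a ^ 2 * (b + 2)) := by
    by_contra hneg
    exact absurd h1 (not_le.2 (div_neg_of_neg_of_pos (not_le.1 hneg) (by positivity)))
  nlinarith [sq_nonneg a]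

/-- Finitely many vectors, measured by the possibly degenerate form `⟪u, A u⟫`, are represented
in a Euclidean space. -/
theorem exists_euclidean_parametrization {A : F →L[ℝ] F} (hA : A.IsPositive) {N : ℕ}
    (u : Fin N → F) :
    ∃ (d : ℕ) (R : EuclideanSpace ℝ (Fin d) →ₗ[ℝ] F), (∀ y, ⟪R y, A (R y)⟫ ≤ ‖y‖ ^ 2) ∧
      ∀ j, ∃ y, A (R y) = A (u j) ∧ ‖y‖ ^ 2 = ⟪u j, A (u j)⟫ := by
  let E : Submodule ℝ F := Submodule.span ℝ (range u)
  have hEfin : FiniteDimensional ℝ E := FiniteDimensional.span_of_finite ℝ (finite_range u)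
  let B : LinearMap.BilinForm ℝ E := LinearMap.mk₂ ℝ (fun x y : E => ⟪(x : F), A y⟫)
    (fun x y z => by simp [inner_add_left]) (fun c x y => by simp [inner_smul_left])
    (fun x y z => by simp [inner_add_right]) (fun c x y => by simp [inner_smul_right])
  have hB : LinearMap.IsSymm (I := RingHom.id ℝ) B := ⟨fun x y => inner_map_symm hA _ _⟩
  obtain ⟨v, hv⟩ := LinearMap.BilinForm.exists_orthogonal_basis (B := B) hB
  have hortho : ∀ i j, i ≠ j → ⟪(v i : F), A (v j)⟫ = 0 := fun i j hij => hv hij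
  set β : Fin (Module.finrank ℝ E) → ℝ := fun i => ⟪(v i : F), A (v i)⟫ with hβ
  have hβ0 : ∀ i, 0 ≤ β i := fun i => inner_map_nonneg hA _
  have hquad : ∀ c : Fin (Module.finrank ℝ E) → ℝ,
      ⟪∑ i, c i • (v i : F), A (∑ i, c i • (v i : F))⟫ = ∑ i, c i ^ 2 * β i := fun c => by
    rw [map_sum, sum_inner]
    refine Finset.sum_congr rfl fun i _ => ?_
    rw [inner_sum, Finset.sum_eq_single i]
    · simp only [map_smul, inner_smul_left, inner_smul_right, RCLike.conj_to_real, hβ]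
      ring
    · intro j _ hji
      simp [inner_smul_left, inner_smul_right, hortho i j hji.symm]
    · simp
  -- where `β i = 0` the coefficient is `y i / 0 = 0`, and `v i` lies in the kernel of `A`
  let R : EuclideanSpace ℝ (Fin (Module.finrank ℝ E)) →ₗ[ℝ] F :=
    { toFun := fun y => ∑ i, (y i / √(β i)) • (v i : F)
      map_add' := fun x y => by simp [add_div, add_smul, Finset.sum_add_distrib]
      map_smul' := fun c x => by simp [mul_div_assoc, mul_smul, Finset.smul_sum] }
  refine ⟨_, R, fun y => ?_, fun j => ?_⟩
  · change ⟪∑ i, (y i / √(β i)) • (v i : F), A (∑ i, (y i / √(β i)) • (v i : F))⟫ ≤ _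
    rw [hquad, EuclideanSpace.real_norm_sq_eq]
    refine Finset.sum_le_sum fun i _ => ?_
    rw [div_pow, Real.sq_sqrt (hβ0 i)]
    rcases (hβ0 i).eq_or_lt with h0 | h0
    · simp [← h0, sq_nonneg]
    · rw [div_mul_cancel₀ _ h0.ne']
  · set c := v.repr ⟨u j, Submodule.subset_span (mem_range_self j)⟩ with hc
    have huj : u j = ∑ i, c i • (v i : F) := by
      have := congrArg (Subtype.val) (v.sum_repr ⟨u j, Submodule.subset_span (mem_range_self j)⟩)
      rw [Submodule.coe_sum] at this
      exact this.symm
    refine ⟨WithLp.toLp 2 fun i => c i * √(β i), ?_, ?_⟩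
    · change A (∑ i, (c i * √(β i) / √(β i)) • (v i : F)) = _
      rw [huj, map_sum, map_sum]
      refine Finset.sum_congr rfl fun i _ => ?_
      rcases (hβ0 i).eq_or_lt with h0 | h0
      · rw [map_smul, map_smul, map_eq_zero_of_inner_eq_zero hA h0.symm, smul_zero, smul_zero]
      · rw [mul_div_cancel_right₀ _ (Real.sqrt_ne_zero'.2 h0)]
    · rw [huj, hquad, EuclideanSpace.real_norm_sq_eq]
      refine Finset.sum_congr rfl fun i _ => ?_
      simp [mul_pow, Real.sq_sqrt (hβ0 i)]

end Gram

/-! ### The exponential inequality for log-weights -/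

section Mixture

open ProbabilityTheory

variable {F : Type*} [NormedAddCommGroup F] [InnerProductSpace ℝ F] {Z : Type*} [MeasurableSpace Z]

/-- The log-weight of a tangent vector `v` for a random linear functional `Y`: the sum of
`Y(zᵢ) v - (Y(zᵢ) v)² / 2` over the sample, minus `n` times the bound `𝔼 Y v + 𝔼 (Y v)² / 2` for the
logarithm of the exponential moment of one summand. -/
noncomputable def logWeight (P : Measure Z) {n : ℕ} (Y : Z → F →L[ℝ] ℝ) (S : Fin n → Z) (v : F) :
    ℝ :=
  ∑ i, (Y (S i) v - Y (S i) v ^ 2 / 2) - n * (∫ z, Y z v ∂P + (∫ z, Y z v ^ 2 ∂P) / 2)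

variable (P : Measure Z) [IsProbabilityMeasure P] (n : ℕ)

section Euclidean

variable {H : Type*} [NormedAddCommGroup H] [InnerProductSpace ℝ H] [FiniteDimensional ℝ H]
  [MeasurableSpace H] [BorelSpace H] {Y : Z → H →L[ℝ] ℝ} {l : ℝ}

/-- The Gaussian average of the weights dominates the weight of every single direction, up to
the penalty `‖x₀‖² / 2 + n l²`. -/
theorem exp_logWeight_le_lintegral_stdGaussian (hY : ∀ v, Measurable fun z => Y z v)
    (hl : ∀ z, ‖Y z‖ ≤ l) (S : Fin n → Z) (x₀ : H) :
    ENNReal.ofReal (Real.exp (logWeight P Y S x₀ - ‖x₀‖ ^ 2 / 2 - n * l ^ 2)) ≤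
      ∫⁻ x, ENNReal.ofReal (Real.exp (logWeight P Y S x)) ∂(stdGaussian H) := by
  have hYb : ∀ x z, ‖Y z x‖ ≤ l * ‖x‖ := fun x z =>
    ((Y z).le_opNorm x).trans (by gcongr; exact hl z)
  have hYint : ∀ x, Integrable (fun z => Y z x) P := fun x =>
    Integrable.of_bound (hY x).aestronglyMeasurable _ (ae_of_all _ (hYb x))
  have hYsq : ∀ x (m : Measure Z) [IsFiniteMeasure m], Integrable (fun z => Y z x ^ 2) m :=
    fun x m _ => by
      refine Integrable.of_bound ((hY x).pow_const 2).aestronglyMeasurable ((l * ‖x‖) ^ 2)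
        (ae_of_all _ fun z => ?_)
      rw [norm_pow]
      exact pow_le_pow_left₀ (norm_nonneg _) (hYb x z) 2
  let a₀ : H →ₗ[ℝ] ℝ :=
    { toFun := fun x => ∫ z, Y z x ∂P
      map_add' := fun x y => by simp only [map_add]; exact integral_add (hYint x) (hYint y)
      map_smul' := fun c x => by
        simp only [map_smul, smul_eq_mul, RingHom.id_apply]; exact integral_const_mul _ _ }
  let a : H →L[ℝ] ℝ := ∑ i, Y (S i) - (n : ℝ) • LinearMap.toContinuousLinearMap a₀
  have ha : ∀ x, a x = ∑ i, Y (S i) x - n * ∫ z, Y z x ∂P := fun x => by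
    simp [a, a₀]
  have hnP : IsFiniteMeasure (n • P) := by
    rw [← Nat.cast_smul_eq_nsmul ℝ≥0]; infer_instance
  -- the squares are integrated against the sample plus `n` copies of `P`, of total mass `2 n`
  set ν : Measure Z := ∑ i, Measure.dirac (S i) + n • P with hν
  have hνuniv : ν.real univ = 2 * n := by
    simp only [hν, Measure.real, Measure.coe_add, Pi.add_apply, Measure.coe_finsetSum,
      Finset.sum_apply, measure_univ, Finset.sum_const, Finset.card_univ, Fintype.card_fin,
      Measure.smul_apply, nsmul_eq_mul, mul_one]
    rw [← Nat.cast_add, ENNReal.toReal_natCast]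
    push_cast; ring
  have hνint : ∀ x, ∫ z, Y z x ^ 2 ∂ν = ∑ i, Y (S i) x ^ 2 + n * ∫ z, Y z x ^ 2 ∂P := by
    intro x
    have h2 : ∀ i ∈ Finset.univ, Integrable (fun z => Y z x ^ 2) (Measure.dirac (S i)) :=
      fun i _ => hYsq x _
    rw [hν, integral_add_measure (integrable_finsetSum_measure.2 h2) (hYsq x _),
      integral_finsetSum_measure h2, ← Nat.cast_smul_eq_nsmul ℝ≥0∞, integral_smul_measure]
    congr 1
    · exact Finset.sum_congr rfl fun i _ =>
        integral_dirac' _ _ ((hY x).pow_const 2).stronglyMeasurable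
  have hlw : ∀ x, logWeight P Y S x = a x - (∫ z, Y z x ^ 2 ∂ν) / 2 := fun x => by
    rw [hνint, ha, logWeight, Finset.sum_sub_distrib, ← Finset.sum_div]
    ring
  have hνfin : IsFiniteMeasure ν := by rw [hν]; infer_instance
  have key := exp_le_lintegral_stdGaussian ν Y hY l hl a x₀
  simp_rw [← hlw] at key
  rw [hνuniv] at key
  have he : l ^ 2 * (2 * (n : ℝ)) / 2 = n * l ^ 2 := by ring
  rwa [he] at key

theorem lintegral_lintegral_exp_logWeight_le (hY : ∀ v, Measurable fun z => Y z v)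
    (hl : ∀ z, ‖Y z‖ ≤ l) :
    ∫⁻ S : Fin n → Z, ∫⁻ x, ENNReal.ofReal (Real.exp (logWeight P Y S x)) ∂(stdGaussian H)
      ∂(Measure.pi fun _ => P) ≤ 1 := by
  have hYj : Measurable fun p : H × Z => Y p.2 p.1 :=
    measurable_uncurry_of_continuous_of_measurable (u := fun x (z : Z) => Y z x)
      (fun z => (Y z).continuous) hY
  have hjoint : Measurable fun p : (Fin n → Z) × H => logWeight P Y p.1 p.2 := by
    have h1 : ∀ i, Measurable fun p : (Fin n → Z) × H => Y (p.1 i) p.2 := fun i =>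
      hYj.comp (measurable_snd.prodMk ((measurable_pi_apply i).comp measurable_fst))
    have h2 : Measurable fun x : H => ∫ z, Y z x ∂P :=
      (hYj.stronglyMeasurable.integral_prod_right (ν := P)).measurable
    have h3 : Measurable fun x : H => ∫ z, Y z x ^ 2 ∂P :=
      ((hYj.pow_const 2).stronglyMeasurable.integral_prod_right (ν := P)).measurable
    simp only [logWeight]
    exact (Finset.measurable_sum _ fun i _ => (h1 i).sub (((h1 i).pow_const 2).div_const 2)).sub
      (((h2.comp measurable_snd).add ((h3.comp measurable_snd).div_const 2)).const_mul _)
  rw [lintegral_lintegral_swap (by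
    simp only [Function.uncurry_def]; exact hjoint.exp.ennreal_ofReal.aemeasurable)]
  calc ∫⁻ x, ∫⁻ S : Fin n → Z, ENNReal.ofReal (Real.exp (logWeight P Y S x))
        ∂(Measure.pi fun _ => P) ∂(stdGaussian H)
      ≤ ∫⁻ _, 1 ∂(stdGaussian H) :=
        lintegral_mono fun x => lintegral_exp_selfNormalized_le P n (hY x) (K := l * ‖x‖)
          fun z => ((Y z).le_opNorm x).trans (by gcongr; exact hl z)
    _ = 1 := by simp

end Euclidean

/-- Uniform exponential inequality over a sequence of directions `A uⱼ`, with a price `n l² / λ`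
that does not depend on the number of directions. -/
theorem lintegral_iSup_exp_logWeight_le {A : F →L[ℝ] F} (hA : A.IsPositive)
    {Y : Z → F →L[ℝ] ℝ} (hY : ∀ v, Measurable fun z => Y z v) {l : ℝ} (hl0 : 0 ≤ l)
    (hl : ∀ z u, Y z (A u) ^ 2 ≤ l ^ 2 * ⟪u, A u⟫) {lam : ℝ} (hlam : 0 < lam) (u : ℕ → F) :
    ∫⁻ S : Fin n → Z, ⨆ j, ENNReal.ofReal (Real.exp (logWeight P Y S (A (u j))
      - lam / 2 * ⟪u j, A (u j)⟫ - n * l ^ 2 / lam)) ∂(Measure.pi fun _ => P) ≤ 1 := by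
  set g : ℕ → (Fin n → Z) → ℝ≥0∞ := fun j S => ENNReal.ofReal (Real.exp (logWeight P Y S (A (u j))
      - lam / 2 * ⟪u j, A (u j)⟫ - n * l ^ 2 / lam)) with hg
  have hgm : ∀ j, Measurable (g j) := fun j => by
    have : ∀ i, Measurable fun S : Fin n → Z => Y (S i) (A (u j)) := fun i =>
      (hY _).comp (measurable_pi_apply i)
    simp only [hg, logWeight]
    fun_prop
  have hsup : ∀ S, ⨆ j, g j S = ⨆ N, ⨆ j : Fin N, g j S := fun S => by
    refine le_antisymm (iSup_le fun j => ?_) (iSup_le fun N => iSup_le fun j => ?_)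
    · exact le_iSup_of_le (j + 1) (le_iSup_of_le (⟨j, j.lt_succ_self⟩ : Fin (j + 1)) le_rfl)
    · exact le_iSup (fun j => g j S) j
  -- monotone convergence reduces to finitely many directions
  rw [lintegral_congr hsup, lintegral_iSup (f := fun N S => ⨆ j : Fin N, g j S)
    (fun N => .iSup fun j => hgm j) ?_]
  swap
  · intro N M hNM S
    exact iSup_le fun j => le_iSup_of_le (⟨j, j.2.trans_le hNM⟩ : Fin M) le_rfl
  refine iSup_le fun N => ?_
  obtain ⟨d, R, hR, hRu⟩ := exists_euclidean_parametrization hA fun j : Fin N => u j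
  set r : ℝ := √lam with hr
  have hr0 : 0 < r := Real.sqrt_pos.2 hlam
  have hr2 : r ^ 2 = lam := Real.sq_sqrt hlam.le
  -- the Gaussian direction `T x` has covariance at most `lam⁻¹ A`
  obtain ⟨T, hT⟩ : ∃ T : EuclideanSpace ℝ (Fin d) →L[ℝ] F, ∀ x, T x = r⁻¹ • A (R x) :=
    ⟨A.comp (LinearMap.toContinuousLinearMap (r⁻¹ • R)), fun x => by simp⟩
  set Y' : Z → EuclideanSpace ℝ (Fin d) →L[ℝ] ℝ := fun z => (Y z).comp T with hY'
  have hlw : ∀ (S : Fin n → Z) x, logWeight P Y' S x = logWeight P Y S (T x) := fun _ _ => rfl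
  have hY'm : ∀ v, Measurable fun z => Y' z v := fun v => hY _
  have hY'l : ∀ z, ‖Y' z‖ ≤ l / r := fun z => by
    refine ContinuousLinearMap.opNorm_le_bound _ (by positivity) fun x => ?_
    refine abs_le_of_sq_le_sq ?_ (by positivity)
    have h1 := hl z (R x)
    have h2 := hR x
    rw [hY', ContinuousLinearMap.comp_apply, hT, map_smul, smul_eq_mul, mul_pow, mul_pow, div_pow,
      inv_pow]
    calc (r ^ 2)⁻¹ * Y z (A (R x)) ^ 2 ≤ (r ^ 2)⁻¹ * (l ^ 2 * ‖x‖ ^ 2) := by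
          gcongr
          exact h1.trans (by gcongr)
      _ = l ^ 2 / r ^ 2 * ‖x‖ ^ 2 := by ring
  refine (lintegral_mono fun S => iSup_le fun j => ?_).trans
    (lintegral_lintegral_exp_logWeight_le P n hY'm hY'l)
  obtain ⟨y, hy1, hy2⟩ := hRu j
  refine le_trans (le_of_eq ?_)
    (exp_logWeight_le_lintegral_stdGaussian P n hY'm hY'l S (r • y))
  have hTy : T (r • y) = A (u j) := by
    rw [hT, map_smul, map_smul, smul_smul, inv_mul_cancel₀ hr0.ne', one_smul, hy1]
  have hnorm : ‖r • y‖ ^ 2 = lam * ⟪u j, A (u j)⟫ := by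
    rw [norm_smul, mul_pow, hy2, Real.norm_of_nonneg hr0.le, hr2]
  rw [hlw, hTy, hnorm, div_pow, hr2]
  simp only [hg]
  congr 2
  ring

end Mixture

/-! ### The dual energy -/

section DualEnergy

variable {F : Type*} [NormedAddCommGroup F] [InnerProductSpace ℝ F]

/-- The energy `sup_u (2 ⟪v, u⟫ - ⟪u, A u⟫)`. It equals `⟪v, A⁻¹ v⟫` on the range of `A`, and it is
the squared norm of `v` in the range of `A ^ (1 / 2)`. -/
noncomputable def dualEnergy (A : F →L[ℝ] F) (v : F) : ℝ≥0∞ :=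
  ⨆ u : F, ENNReal.ofReal (2 * ⟪v, u⟫ - ⟪u, A u⟫)

theorem dualEnergy_le_localNorm_sq {A : F →L[ℝ] F} (hA : A.IsPositive) (v : F) :
    dualEnergy A v ≤ localNorm A v ^ 2 := by
  have h : ∀ u, A u = v → dualEnergy A v ≤ ENNReal.ofReal (√⟪v, u⟫) ^ 2 := by
    rintro u rfl
    have h0 : 0 ≤ ⟪A u, u⟫ := by rw [real_inner_comm]; exact inner_map_nonneg hA u
    rw [← ENNReal.ofReal_pow (Real.sqrt_nonneg _), Real.sq_sqrt h0]
    refine iSup_le fun w => ENNReal.ofReal_le_ofReal ?_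
    have := inner_map_nonneg hA (u - w)
    simp only [map_sub, inner_sub_left, inner_sub_right] at this
    rw [real_inner_comm u (A u), real_inner_comm w (A u)]
    linarith [inner_map_symm hA u w]
  have h2 : dualEnergy A v ^ (2⁻¹ : ℝ) ≤ localNorm A v := le_iInf₂ fun u hu => by
    rw [ENNReal.rpow_inv_le_iff (by norm_num)]
    exact_mod_cast h u hu
  rw [ENNReal.rpow_inv_le_iff (by norm_num)] at h2
  exact_mod_cast h2

theorem dualEnergy_smul_le (A : F →L[ℝ] F) (v : F) {c : ℝ} (hc : 0 < c) :
    dualEnergy A (c • v) ≤ ENNReal.ofReal (c ^ 2) * dualEnergy A v := by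
  refine iSup_le fun u => ?_
  have : 2 * ⟪c • v, u⟫ - ⟪u, A u⟫ =
      c ^ 2 * (2 * ⟪v, c⁻¹ • u⟫ - ⟪c⁻¹ • u, A (c⁻¹ • u)⟫) := by
    simp only [map_smul, inner_smul_left, inner_smul_right, RCLike.conj_to_real]
    field_simp
  rw [this, ENNReal.ofReal_mul (by positivity)]
  gcongr
  exact le_iSup (fun w => ENNReal.ofReal (2 * ⟪v, w⟫ - ⟪w, A w⟫)) _

theorem dualEnergy_smul (A : F →L[ℝ] F) (v : F) {c : ℝ} (hc : 0 < c) :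
    dualEnergy A (c • v) = ENNReal.ofReal (c ^ 2) * dualEnergy A v := by
  refine le_antisymm (dualEnergy_smul_le A v hc) ?_
  have h := dualEnergy_smul_le A (c • v) (inv_pos.2 hc)
  rw [smul_smul, inv_mul_cancel₀ hc.ne', one_smul] at h
  calc ENNReal.ofReal (c ^ 2) * dualEnergy A v
      ≤ ENNReal.ofReal (c ^ 2) * (ENNReal.ofReal (c⁻¹ ^ 2) * dualEnergy A (c • v)) := by gcongr
    _ = dualEnergy A (c • v) := by
        rw [← mul_assoc, ← ENNReal.ofReal_mul (by positivity), ← mul_pow, mul_inv_cancel₀ hc.ne']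
        simp

theorem le_toReal_dualEnergy {A : F →L[ℝ] F} {v : F} (hv : dualEnergy A v ≠ ∞) (u : F) :
    2 * ⟪v, u⟫ - ⟪u, A u⟫ ≤ (dualEnergy A v).toReal :=
  (ENNReal.ofReal_le_iff_le_toReal hv).1
    (le_iSup (fun u => ENNReal.ofReal (2 * ⟪v, u⟫ - ⟪u, A u⟫)) u)

/-- Cauchy–Schwarz: a linear form that is `l`-bounded on the range of `A` is `l`-bounded with
respect to the dual energy. -/
theorem ofReal_sq_le_dualEnergy [CompleteSpace F] {A : F →L[ℝ] F} {Y : F →L[ℝ] ℝ} {l : ℝ}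
    (hl0 : 0 < l) (hl : ∀ u, Y (A u) ^ 2 ≤ l ^ 2 * ⟪u, A u⟫) (v : F) :
    ENNReal.ofReal (Y v ^ 2) ≤ ENNReal.ofReal (l ^ 2) * dualEnergy A v := by
  set y : F := (InnerProductSpace.toDual ℝ F).symm Y with hy
  have hYy : ∀ w, Y w = ⟪y, w⟫ := fun w => by rw [hy, InnerProductSpace.toDual_symm_apply]
  have hb : ⟪y, A y⟫ ≤ l ^ 2 := by
    have h1 := hl y
    rw [hYy] at h1
    by_contra hlt
    push Not at hlt
    nlinarith [sq_nonneg l]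
  refine le_trans ?_ (mul_le_mul_right (le_iSup (fun u => ENNReal.ofReal (2 * ⟪v, u⟫ - ⟪u, A u⟫))
    ((Y v / l ^ 2) • y)) _)
  rw [← ENNReal.ofReal_mul (by positivity)]
  refine ENNReal.ofReal_le_ofReal ?_
  simp only [map_smul, inner_smul_left, inner_smul_right, RCLike.conj_to_real]
  rw [real_inner_comm y v, ← hYy v]
  have : l ^ 2 * (2 * (Y v / l ^ 2 * Y v) - Y v / l ^ 2 * (Y v / l ^ 2 * ⟪y, A y⟫))
      = 2 * Y v ^ 2 - Y v ^ 2 * (⟪y, A y⟫ / l ^ 2) := by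
    field_simp
  rw [this]
  have h3 : ⟪y, A y⟫ / l ^ 2 ≤ 1 := div_le_one_of_le₀ hb (by positivity)
  nlinarith [sq_nonneg (Y v)]

theorem sq_le_toReal_dualEnergy [CompleteSpace F] {A : F →L[ℝ] F} {Y : F →L[ℝ] ℝ} {l : ℝ}
    (hl0 : 0 < l) (hl : ∀ u, Y (A u) ^ 2 ≤ l ^ 2 * ⟪u, A u⟫) {v : F} (hv : dualEnergy A v ≠ ∞) :
    Y v ^ 2 ≤ l ^ 2 * (dualEnergy A v).toReal := by
  have := ofReal_sq_le_dualEnergy hl0 hl v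
  rw [← ENNReal.ofReal_toReal hv, ← ENNReal.ofReal_mul (by positivity)] at this
  exact (ENNReal.ofReal_le_ofReal_iff (by positivity)).1 this

section Dense

variable [TopologicalSpace.SeparableSpace F]

theorem exists_denseSeq_lt (A : F →L[ℝ] F) (v u : F) {ε : ℝ} (hε : 0 < ε) :
    ∃ j, 2 * ⟪v, u⟫ - ⟪u, A u⟫ - ε < 2 * ⟪v, TopologicalSpace.denseSeq F j⟫
      - ⟪TopologicalSpace.denseSeq F j, A (TopologicalSpace.denseSeq F j)⟫ := by
  have hc : Continuous fun u : F => 2 * ⟪v, u⟫ - ⟪u, A u⟫ := by fun_prop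
  have ho : IsOpen {w : F | 2 * ⟪v, u⟫ - ⟪u, A u⟫ - ε < 2 * ⟪v, w⟫ - ⟪w, A w⟫} :=
    isOpen_lt continuous_const hc
  obtain ⟨j, hj⟩ := (TopologicalSpace.denseRange_denseSeq F).exists_mem_open ho
    ⟨u, by simpa using hε⟩
  exact ⟨j, hj⟩

theorem dualEnergy_eq_iSup_denseSeq (A : F →L[ℝ] F) (v : F) :
    dualEnergy A v = ⨆ j, ENNReal.ofReal (2 * ⟪v, TopologicalSpace.denseSeq F j⟫
      - ⟪TopologicalSpace.denseSeq F j, A (TopologicalSpace.denseSeq F j)⟫) := by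
  refine le_antisymm (iSup_le fun u => ?_) (iSup_le fun j => le_iSup
    (fun u => ENNReal.ofReal (2 * ⟪v, u⟫ - ⟪u, A u⟫)) _)
  refine ENNReal.le_of_forall_pos_le_add fun ε hε _ => ?_
  obtain ⟨j, hj⟩ := exists_denseSeq_lt A v u (NNReal.coe_pos.2 hε)
  calc ENNReal.ofReal (2 * ⟪v, u⟫ - ⟪u, A u⟫)
      ≤ ENNReal.ofReal (2 * ⟪v, TopologicalSpace.denseSeq F j⟫
      - ⟪TopologicalSpace.denseSeq F j, A (TopologicalSpace.denseSeq F j)⟫ + ε) :=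
        ENNReal.ofReal_le_ofReal (by linarith)
    _ ≤ _ := ENNReal.ofReal_add_le
    _ ≤ _ := by
        rw [ENNReal.ofReal_coe_nnreal]
        gcongr
        exact le_iSup (fun j => ENNReal.ofReal (2 * ⟪v, TopologicalSpace.denseSeq F j⟫
      - ⟪TopologicalSpace.denseSeq F j, A (TopologicalSpace.denseSeq F j)⟫)) j

theorem measurable_dualEnergy [MeasurableSpace F] [BorelSpace F] {α : Type*} [MeasurableSpace α]
    {A : α → F →L[ℝ] F} (hA : ∀ u, Measurable fun x => A x u) {v : α → F} (hv : Measurable v) :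
    Measurable fun x => dualEnergy (A x) (v x) := by
  have : SecondCountableTopology F := UniformSpace.secondCountable_of_separable F
  simp_rw [dualEnergy_eq_iSup_denseSeq]
  exact .iSup fun j => (((hv.inner measurable_const).const_mul 2).sub
    (measurable_const.inner (hA _))).ennreal_ofReal

/-- A vector of finite dual energy is approximated, in dual energy, by images under `A` of members
of a dense sequence: along a maximising sequence `u` of `2 ⟪v, u⟫ - ⟪u, A u⟫`, the energy of
`v - A u` is the gap to the supremum. -/
theorem exists_seq_tendsto_dualEnergy {A : F →L[ℝ] F} (hA : A.IsPositive) {v : F}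
    (hv : dualEnergy A v ≠ ∞) :
    ∃ j : ℕ → ℕ,
      (∀ k, dualEnergy A (v - A (TopologicalSpace.denseSeq F (j k))) ≤
        ENNReal.ofReal (1 / ((k : ℝ) + 1))) ∧
      Tendsto (fun k => ⟪TopologicalSpace.denseSeq F (j k),
        A (TopologicalSpace.denseSeq F (j k))⟫) atTop (𝓝 (dualEnergy A v).toReal) := by
  set e : ℝ := (dualEnergy A v).toReal with he
  have he0 : 0 ≤ e := ENNReal.toReal_nonneg
  have hmax : ∀ ε : ℝ, 0 < ε → ∃ u, e - ε < 2 * ⟪v, u⟫ - ⟪u, A u⟫ := fun ε hε => by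
    rcases lt_or_ge (e - ε) 0 with h | h
    · exact ⟨0, by simpa using h⟩
    · have : ENNReal.ofReal (e - ε) < dualEnergy A v :=
        (ENNReal.ofReal_lt_iff_lt_toReal h hv).2 (by linarith)
      obtain ⟨u, hu⟩ := lt_iSup_iff.1 this
      exact ⟨u, (ENNReal.ofReal_lt_ofReal_iff'.1 hu).1⟩
  have hseq : ∀ k : ℕ, ∃ j, e - 1 / ((k : ℝ) + 1) < 2 * ⟪v, TopologicalSpace.denseSeq F j⟫
      - ⟪TopologicalSpace.denseSeq F j, A (TopologicalSpace.denseSeq F j)⟫ := fun k => by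
    have hk : 0 < 1 / ((k : ℝ) + 1) := by positivity
    obtain ⟨u, hu⟩ := hmax (1 / ((k : ℝ) + 1) / 2) (by positivity)
    obtain ⟨j, hj⟩ := exists_denseSeq_lt A v u (half_pos hk)
    exact ⟨j, by linarith⟩
  choose j hj using hseq
  refine ⟨j, fun k => ?_, ?_⟩
  · set w := TopologicalSpace.denseSeq F (j k)
    refine iSup_le fun u => ENNReal.ofReal_le_ofReal ?_
    have h1 := le_toReal_dualEnergy hv (u + w)
    simp only [map_add, inner_add_left, inner_add_right] at h1
    rw [inner_sub_left, real_inner_comm u (A w)]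
    linarith [hj k, inner_map_symm hA u w]
  · -- the scaled competitors `s • u` give `(√b - √e)² ≤ ε` for `b = ⟪u, A u⟫`
    have hsq : ∀ k, (√⟪TopologicalSpace.denseSeq F (j k), A (TopologicalSpace.denseSeq F (j k))⟫
        - √e) ^ 2 ≤ 1 / ((k : ℝ) + 1) := fun k => by
      set w := TopologicalSpace.denseSeq F (j k)
      have hb0 : 0 ≤ ⟪w, A w⟫ := inner_map_nonneg hA w
      have hp : ⟪v, w⟫ ≤ √e * √⟪w, A w⟫ := by
        have hq : ∀ t : ℝ, 0 ≤ ⟪w, A w⟫ * (t * t) + (-2 * ⟪v, w⟫) * t + e := fun t => by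
          have h1 := le_toReal_dualEnergy hv (t • w)
          simp only [map_smul, inner_smul_left, inner_smul_right, RCLike.conj_to_real] at h1
          linarith
        have hd := discrim_le_zero hq
        rw [discrim] at hd
        rw [← Real.sqrt_mul he0]
        refine Real.le_sqrt_of_sq_le ?_
        linarith
      have h2 := hj k
      nlinarith [Real.sq_sqrt he0, Real.sq_sqrt hb0]
    have h0 : Tendsto (fun k => (√⟪TopologicalSpace.denseSeq F (j k),
        A (TopologicalSpace.denseSeq F (j k))⟫ - √e) ^ 2) atTop (𝓝 0) :=
      squeeze_zero (fun _ => sq_nonneg _) hsq tendsto_one_div_add_atTop_nhds_zero_nat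
    have h1 : Tendsto (fun k => √⟪TopologicalSpace.denseSeq F (j k),
        A (TopologicalSpace.denseSeq F (j k))⟫ - √e) atTop (𝓝 0) := by
      have h3 := (Real.continuous_sqrt.tendsto 0).comp h0
      simp only [Function.comp_def, Real.sqrt_sq_eq_abs, Real.sqrt_zero] at h3
      exact (tendsto_zero_iff_abs_tendsto_zero _).2 h3
    have h2 : Tendsto (fun k => √⟪TopologicalSpace.denseSeq F (j k),
        A (TopologicalSpace.denseSeq F (j k))⟫) atTop (𝓝 √e) := by
      simpa using h1.add_const √e
    have h3 := h2.pow 2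
    rw [Real.sq_sqrt he0] at h3
    refine h3.congr fun k => Real.sq_sqrt (inner_map_nonneg hA _)

variable [CompleteSpace F] {Z : Type*} [MeasurableSpace Z] (P : Measure Z) [IsProbabilityMeasure P]

/-- The supremum over the images of a dense sequence controls every direction of finite dual
energy, including those outside the range of `A`. -/
theorem exp_logWeight_le_iSup_denseSeq {A : F →L[ℝ] F} (hA : A.IsPositive)
    {Y : Z → F →L[ℝ] ℝ} (hY : ∀ v, Measurable fun z => Y z v) {l : ℝ} (hl0 : 0 < l)
    (hl : ∀ z u, Y z (A u) ^ 2 ≤ l ^ 2 * ⟪u, A u⟫) (lam : ℝ) {n : ℕ} (S : Fin n → Z) {v : F}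
    (hv : dualEnergy A v ≠ ∞) :
    ENNReal.ofReal (Real.exp (logWeight P Y S v - lam / 2 * (dualEnergy A v).toReal
      - n * l ^ 2 / lam)) ≤
    ⨆ j, ENNReal.ofReal (Real.exp (logWeight P Y S (A (TopologicalSpace.denseSeq F j))
      - lam / 2 * ⟪TopologicalSpace.denseSeq F j, A (TopologicalSpace.denseSeq F j)⟫
      - n * l ^ 2 / lam)) := by
  obtain ⟨j, hj1, hj2⟩ := exists_seq_tendsto_dualEnergy hA hv
  set w : ℕ → F := fun k => TopologicalSpace.denseSeq F (j k) with hw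
  have hYlim : ∀ z, Tendsto (fun k => Y z (A (w k))) atTop (𝓝 (Y z v)) := fun z => by
    have h1 : ∀ k, Y z (v - A (w k)) ^ 2 ≤ l ^ 2 * (1 / ((k : ℝ) + 1)) := fun k => by
      have hne : dualEnergy A (v - A (w k)) ≠ ∞ := ((hj1 k).trans_lt ENNReal.ofReal_lt_top).ne
      refine (sq_le_toReal_dualEnergy hl0 (hl z) hne).trans ?_
      gcongr
      exact ENNReal.toReal_le_of_le_ofReal (by positivity) (hj1 k)
    have h2 : Tendsto (fun k => Y z (v - A (w k)) ^ 2) atTop (𝓝 0) := by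
      refine squeeze_zero (fun _ => sq_nonneg _) h1 ?_
      simpa using tendsto_one_div_add_atTop_nhds_zero_nat.const_mul (l ^ 2)
    have h3 := (Real.continuous_sqrt.tendsto 0).comp h2
    simp only [Function.comp_def, Real.sqrt_sq_eq_abs, Real.sqrt_zero] at h3
    have h4 := (tendsto_zero_iff_abs_tendsto_zero _).2 h3
    have h5 := h4.const_sub (Y z v)
    simpa [map_sub] using h5
  obtain ⟨C, hC⟩ := hj2.bddAbove_range
  have hbd : ∀ k z, Y z (A (w k)) ^ 2 ≤ l ^ 2 * C := fun k z =>
    (hl z (w k)).trans (by gcongr; exact hC (mem_range_self k))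
  have hint1 : Tendsto (fun k => ∫ z, Y z (A (w k)) ∂P) atTop (𝓝 (∫ z, Y z v ∂P)) :=
    tendsto_integral_of_dominated_convergence (fun _ => √(l ^ 2 * C))
      (fun k => (hY _).aestronglyMeasurable) (integrable_const _)
      (fun k => ae_of_all _ fun z => Real.abs_le_sqrt (hbd k z)) (ae_of_all _ hYlim)
  have hint2 : Tendsto (fun k => ∫ z, Y z (A (w k)) ^ 2 ∂P) atTop (𝓝 (∫ z, Y z v ^ 2 ∂P)) :=
    tendsto_integral_of_dominated_convergence (fun _ => l ^ 2 * C)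
      (fun k => ((hY _).pow_const 2).aestronglyMeasurable) (integrable_const _)
      (fun k => ae_of_all _ fun z => by
        rw [Real.norm_of_nonneg (sq_nonneg _)]; exact hbd k z)
      (ae_of_all _ fun z => (hYlim z).pow 2)
  have hlw : Tendsto (fun k => logWeight P Y S (A (w k))) atTop (𝓝 (logWeight P Y S v)) :=
    (tendsto_finsetSum _ fun i _ => (hYlim (S i)).sub (((hYlim (S i)).pow 2).div_const 2)).sub
      ((hint1.add (hint2.div_const 2)).const_mul _)
  have hall := ENNReal.tendsto_ofReal ((Real.continuous_exp.tendsto _).comp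
    ((hlw.sub (hj2.const_mul (lam / 2))).sub_const (n * l ^ 2 / lam)))
  refine le_of_tendsto' hall fun k => ?_
  exact le_iSup (fun j => ENNReal.ofReal (Real.exp (logWeight P Y S
      (A (TopologicalSpace.denseSeq F j))
      - lam / 2 * ⟪TopologicalSpace.denseSeq F j, A (TopologicalSpace.denseSeq F j)⟫
      - n * l ^ 2 / lam))) (j k)

end Dense

end DualEnergy

/-! ### The PAC-Bayesian inequality -/

section ChangeOfMeasure

/-- Donsker–Varadhan inequality. -/
theorem integral_le_toReal_klDiv_add_log {α : Type*} [MeasurableSpace α] {Q U : Measure α}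
    [IsProbabilityMeasure Q] [IsProbabilityMeasure U] (hQU : Q ≪ U)
    (hllr : Integrable (llr Q U) Q) {h : α → ℝ} (hh : Integrable h Q) {M : α → ℝ≥0∞}
    (hM : Measurable M) (hhM : ∀ᵐ x ∂Q, ENNReal.ofReal (Real.exp (h x)) ≤ M x) {c : ℝ} (hc : 0 < c)
    (hMc : ∫⁻ x, M x ∂U ≤ ENNReal.ofReal c) :
    ∫ x, h x ∂Q ≤ (InformationTheory.klDiv Q U).toReal + Real.log c := by
  set p : α → ℝ≥0∞ := Q.rnDeriv U with hp
  have hpm : Measurable p := Measure.measurable_rnDeriv Q U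
  have hQ : U.withDensity p = Q := Measure.withDensity_rnDeriv_eq Q U hQU
  have h1 : ∫⁻ x, (p x)⁻¹ * M x ∂Q ≤ ENNReal.ofReal c := by
    conv_lhs => rw [← hQ]
    rw [lintegral_withDensity_eq_lintegral_mul _ hpm (g := fun x => (p x)⁻¹ * M x)
      (hpm.inv.mul hM)]
    refine le_trans (lintegral_mono fun x => ?_) hMc
    simp only [Pi.mul_apply, ← mul_assoc]
    exact mul_le_of_le_one_left zero_le (ENNReal.mul_inv_le_one _)
  set g : α → ℝ := fun x => h x - llr Q U x - Real.log c with hg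
  have hgint : Integrable g Q := (hh.sub hllr).sub (integrable_const _)
  -- `1 + t ≤ exp t` in place of Jensen's inequality
  have h2 : ∫⁻ x, ENNReal.ofReal (1 + g x) ∂Q ≤ 1 := by
    calc ∫⁻ x, ENNReal.ofReal (1 + g x) ∂Q
        ≤ ∫⁻ x, ENNReal.ofReal c⁻¹ * ((p x)⁻¹ * M x) ∂Q := by
          refine lintegral_mono_ae ?_
          filter_upwards [hhM, exp_llr_of_ac Q U hQU, Measure.rnDeriv_pos hQU] with x hx1 hx2 hx3
          have hfac : Real.exp (g x) = c⁻¹ * ((p x).toReal⁻¹ * Real.exp (h x)) := by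
            rw [hg]
            simp only
            rw [Real.exp_sub, Real.exp_sub, hx2, Real.exp_log hc]
            field_simp
            rfl
          calc ENNReal.ofReal (1 + g x) ≤ ENNReal.ofReal (Real.exp (g x)) :=
                ENNReal.ofReal_le_ofReal (by linarith [Real.add_one_le_exp (g x)])
            _ = ENNReal.ofReal c⁻¹ * (ENNReal.ofReal (p x).toReal⁻¹ *
                  ENNReal.ofReal (Real.exp (h x))) := by
                rw [hfac, ENNReal.ofReal_mul (by positivity), ENNReal.ofReal_mul (by positivity)]
            _ ≤ ENNReal.ofReal c⁻¹ * ((p x)⁻¹ * M x) := by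
                gcongr
                rw [← ENNReal.toReal_inv]
                exact ENNReal.ofReal_toReal_le
      _ = ENNReal.ofReal c⁻¹ * ∫⁻ x, (p x)⁻¹ * M x ∂Q :=
          lintegral_const_mul _ (hpm.inv.mul hM)
      _ ≤ ENNReal.ofReal c⁻¹ * ENNReal.ofReal c := by gcongr
      _ = 1 := by rw [← ENNReal.ofReal_mul (by positivity), inv_mul_cancel₀ hc.ne']; simp
  have h3 := (ofReal_integral_le_lintegral ((integrable_const 1).add hgint)).trans h2
  have h4 : ∫ x, (1 + g x) ∂Q ≤ 1 := ENNReal.ofReal_le_one.1 h3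
  rw [integral_add (integrable_const 1) hgint, hg,
    integral_sub (f := fun x => h x - llr Q U x) (hh.sub hllr) (integrable_const _),
    integral_sub hh hllr] at h4
  rw [InformationTheory.toReal_klDiv_of_measure_eq hQU (by simp)]
  simp only [integral_const, probReal_univ, smul_eq_mul, one_mul] at h4
  linarith

end ChangeOfMeasure

section Event

/-- Markov's inequality. -/
theorem ofReal_one_sub_le_measure_le {α : Type*} [MeasurableSpace α] {m : Measure α}
    [IsProbabilityMeasure m] {I : α → ℝ≥0∞} (hI : Measurable I) {c δ : ℝ} (hc : 0 < c) (hδ : 0 < δ)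
    (h : ∫⁻ x, I x ∂m ≤ ENNReal.ofReal c) :
    ENNReal.ofReal (1 - δ) ≤ m {x | I x ≤ ENNReal.ofReal (c / δ)} := by
  have hmarkov := mul_meas_ge_le_lintegral (μ := m) hI (ENNReal.ofReal (c / δ))
  have hcompl : m {x | I x ≤ ENNReal.ofReal (c / δ)}ᶜ ≤ ENNReal.ofReal δ := by
    have h1 : m {x | I x ≤ ENNReal.ofReal (c / δ)}ᶜ ≤ m {x | ENNReal.ofReal (c / δ) ≤ I x} :=
      measure_mono fun x hx => by
        rw [mem_compl_iff, mem_ofPred_eq, not_le] at hx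
        exact hx.le
    have h2 := h1.trans ((ENNReal.le_div_iff_mul_le
      (Or.inl (ENNReal.ofReal_pos.2 (by positivity)).ne') (Or.inl ENNReal.ofReal_ne_top)).2
        ((mul_comm _ _).le.trans (hmarkov.trans h)))
    refine h2.trans (le_of_eq ?_)
    rw [← ENNReal.ofReal_div_of_pos (by positivity)]
    congr 1
    field_simp
  rw [ENNReal.ofReal_sub _ hδ.le, ENNReal.ofReal_one]
  rw [prob_compl_eq_one_sub (measurableSet_le hI measurable_const)] at hcompl
  exact tsub_le_iff_tsub_le.1 hcompl

variable {F Z : Type*} [NormedAddCommGroup F] [InnerProductSpace ℝ F]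
  [TopologicalSpace.SeparableSpace F] [MeasurableSpace F] [BorelSpace F] [MeasurableSpace Z]

/-- The supremum, over the images under `A` of a dense sequence, of the exponentials of the
log-weights penalised by `lam / 2` times the energy and normalised by the trace term. -/
noncomputable def supWeight (P : Measure Z) {n : ℕ} (A : F →L[ℝ] F) (Y : Z → F →L[ℝ] ℝ)
    (l lam : ℝ) (S : Fin n → Z) : ℝ≥0∞ :=
  ⨆ j, ENNReal.ofReal (Real.exp (logWeight P Y S (A (TopologicalSpace.denseSeq F j))
    - lam / 2 * ⟪TopologicalSpace.denseSeq F j, A (TopologicalSpace.denseSeq F j)⟫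
    - n * l ^ 2 / lam))

theorem measurable_supWeight (P : Measure Z) [IsProbabilityMeasure P] (n : ℕ)
    {A : F → F →L[ℝ] F} (hA_meas : ∀ u, Measurable fun f => A f u) {X : F → Z → F →L[ℝ] ℝ}
    (hX : ∀ v : F → F, Measurable v → Measurable fun p : F × Z => X p.1 p.2 (v p.1)) (l lam : ℝ) :
    Measurable fun p : F × (Fin n → Z) => supWeight P (A p.1) (X p.1) l lam p.2 := by
  refine .iSup fun j => ?_
  have h0 := hX _ (hA_meas (TopologicalSpace.denseSeq F j))
  have h1 : ∀ i, Measurable fun p : F × (Fin n → Z) =>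
      X p.1 (p.2 i) (A p.1 (TopologicalSpace.denseSeq F j)) := fun i =>
    h0.comp (measurable_fst.prodMk ((measurable_pi_apply i).comp measurable_snd))
  have h2 : Measurable fun f => ∫ z, X f z (A f (TopologicalSpace.denseSeq F j)) ∂P :=
    (h0.stronglyMeasurable.integral_prod_right (ν := P)).measurable
  have h3 : Measurable fun f => ∫ z, X f z (A f (TopologicalSpace.denseSeq F j)) ^ 2 ∂P :=
    ((h0.pow_const 2).stronglyMeasurable.integral_prod_right (ν := P)).measurable
  have h4 : Measurable fun f =>
      ⟪TopologicalSpace.denseSeq F j, A f (TopologicalSpace.denseSeq F j)⟫ :=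
    (innerSL ℝ (TopologicalSpace.denseSeq F j)).continuous.measurable.comp (hA_meas _)
  have h5 : Measurable fun p : F × (Fin n → Z) =>
      logWeight P (X p.1) p.2 (A p.1 (TopologicalSpace.denseSeq F j)) := by
    simp only [logWeight]
    exact (Finset.measurable_sum _ fun i _ => (h1 i).sub (((h1 i).pow_const 2).div_const 2)).sub
      (((h2.comp measurable_fst).add ((h3.comp measurable_fst).div_const 2)).const_mul _)
  exact ((h5.sub ((h4.comp measurable_fst).const_mul _)).sub_const _).exp.ennreal_ofReal

/-- PAC-Bayesian inequality for the log-weights: one event serves all posteriors `Q`, all vector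
fields `v` of finite dual energy and a finite grid of regularisation parameters. -/
theorem exists_event_integral_logWeight_le [CompleteSpace F] (P : Measure Z)
    [IsProbabilityMeasure P] (n : ℕ) {A : F → F →L[ℝ] F} (hA_pos : ∀ f, (A f).IsPositive)
    (hA_meas : ∀ u, Measurable fun f => A f u) {X : F → Z → F →L[ℝ] ℝ}
    (hX : ∀ v : F → F, Measurable v → Measurable fun p : F × Z => X p.1 p.2 (v p.1))
    {l : ℝ} (hl0 : 0 < l) (hl : ∀ f z u, X f z (A f u) ^ 2 ≤ l ^ 2 * ⟪u, A f u⟫)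
    (U : Measure F) [IsProbabilityMeasure U] {δ : ℝ} (hδ0 : 0 < δ)
    {N : ℕ} (hN : 0 < N) {lam : Fin N → ℝ} (hlam : ∀ k, 0 < lam k) :
    ∃ E : Set (Fin n → Z), MeasurableSet E ∧
      ENNReal.ofReal (1 - δ) ≤ Measure.pi (fun _ : Fin n => P) E ∧
      ∀ S ∈ E, ∀ (Q : Measure F) [IsProbabilityMeasure Q], Q ≪ U → Integrable (llr Q U) Q →
        ∀ (v : F → F) (k : Fin N), (∀ᵐ f ∂Q, dualEnergy (A f) (v f) ≠ ∞) →
        Integrable (fun f => logWeight P (X f) S (v f)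
          - lam k / 2 * (dualEnergy (A f) (v f)).toReal) Q →
        ∫ f, (logWeight P (X f) S (v f) - lam k / 2 * (dualEnergy (A f) (v f)).toReal) ∂Q ≤
          (InformationTheory.klDiv Q U).toReal + Real.log (1 / δ) + Real.log N
            + n * l ^ 2 / lam k := by
  have hXz : ∀ f v, Measurable fun z => X f z v := fun f v =>
    (hX (fun _ => v) measurable_const).comp measurable_prodMk_left
  obtain ⟨G, hG⟩ : ∃ G : Fin N → F → (Fin n → Z) → ℝ≥0∞,
      ∀ k f S, G k f S = supWeight P (A f) (X f) l (lam k) S := ⟨_, fun _ _ _ => rfl⟩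
  have hGm : ∀ k, Measurable fun p : F × (Fin n → Z) => G k p.1 p.2 := fun k => by
    simp only [hG]
    exact measurable_supWeight P n hA_meas hX l (lam k)
  have hGS : ∀ k S, Measurable fun f => G k f S := fun k S => (hGm k).comp measurable_prodMk_right
  have hG1 : ∀ k f, ∫⁻ S, G k f S ∂(Measure.pi fun _ : Fin n => P) ≤ 1 := fun k f => by
    simp only [hG]
    exact lintegral_iSup_exp_logWeight_le P n (hA_pos f) (hXz f) hl0.le (hl f) (hlam k) _
  have hsum : Measurable fun p : F × (Fin n → Z) => ∑ k, G k p.1 p.2 :=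
    Finset.measurable_sum _ fun k _ => hGm k
  have hIm : Measurable fun S : Fin n → Z => ∫⁻ f, ∑ k, G k f S ∂U := hsum.lintegral_prod_left'
  have hI1 : ∫⁻ S, ∫⁻ f, ∑ k, G k f S ∂U ∂(Measure.pi fun _ : Fin n => P)
      ≤ ENNReal.ofReal N := by
    rw [lintegral_lintegral_swap (f := fun S f => ∑ k, G k f S)
      (hsum.comp measurable_swap).aemeasurable]
    calc ∫⁻ f, ∫⁻ S, ∑ k, G k f S ∂(Measure.pi fun _ : Fin n => P) ∂U
        ≤ ∫⁻ _, (N : ℝ≥0∞) ∂U := by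
          refine lintegral_mono fun f => ?_
          rw [lintegral_finsetSum (f := fun k S => G k f S) _ fun k _ =>
            (hGm k).comp measurable_prodMk_left]
          refine (Finset.sum_le_sum fun k _ => hG1 k f).trans ?_
          simp
      _ = ENNReal.ofReal N := by simp
  have hNpos : (0 : ℝ) < N := by exact_mod_cast hN
  refine ⟨{S | ∫⁻ f, ∑ k, G k f S ∂U ≤ ENNReal.ofReal (N / δ)},
    measurableSet_le hIm measurable_const, ofReal_one_sub_le_measure_le hIm hNpos hδ0 hI1, ?_⟩
  · intro S hS Q _ hQU hllr v k hv hint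
    have hint' : Integrable (fun f => logWeight P (X f) S (v f)
          - lam k / 2 * (dualEnergy (A f) (v f)).toReal - n * l ^ 2 / lam k) Q :=
      hint.sub (integrable_const _)
    have key := integral_le_toReal_klDiv_add_log hQU hllr hint' (hGS k S) (c := N / δ) (by
      filter_upwards [hv] with f hf
      rw [hG]
      exact exp_logWeight_le_iSup_denseSeq P (hA_pos f) (hXz f) hl0 (hl f) (lam k) S hf)
      (by positivity) (le_trans (lintegral_mono fun f =>
        Finset.single_le_sum (f := fun k => G k f S) (fun _ _ => zero_le) (Finset.mem_univ k)) hS)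
    rw [integral_sub hint (integrable_const _)] at key
    simp only [integral_const, probReal_univ, smul_eq_mul, one_mul] at key
    have hlog : Real.log (N / δ) = Real.log (1 / δ) + Real.log N := by
      rw [Real.log_div hNpos.ne' hδ0.ne', Real.log_div one_ne_zero hδ0.ne', Real.log_one]
      ring
    linarith

end Event

/-! ### Differentiation of expectations along random paths -/

section Increments

theorem sq_integral_le_mul_integral_sq {α : Type*} [MeasurableSpace α] {m : Measure α}
    [IsFiniteMeasure m] {g : α → ℝ} (hg : MemLp g 2 m) :
    (∫ x, g x ∂m) ^ 2 ≤ m.real univ * ∫ x, g x ^ 2 ∂m := by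
  have hi : Integrable g m := hg.integrable (by norm_num)
  have hi2 : Integrable (fun x => g x ^ 2) m := hg.integrable_sq
  have hq : ∀ t : ℝ, 0 ≤ m.real univ * (t * t) + (-2 * ∫ x, g x ∂m) * t + ∫ x, g x ^ 2 ∂m := by
    intro t
    have h1 : 0 ≤ ∫ x, (g x - t) ^ 2 ∂m := integral_nonneg fun _ => sq_nonneg _
    have h2 : ∫ x, (g x - t) ^ 2 ∂m = ∫ x, (g x ^ 2 - 2 * t * g x + t * t) ∂m :=
      integral_congr_ae (ae_of_all _ fun x => by ring)
    rw [h2, integral_add (f := fun x => g x ^ 2 - 2 * t * g x) (hi2.sub (hi.const_mul _))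
      (integrable_const _), integral_sub hi2 (hi.const_mul _), integral_const_mul, integral_const,
      smul_eq_mul] at h1
    linarith
  have hd := discrim_le_zero hq
  rw [discrim] at hd
  linarith

theorem memLp_two_of_lintegral_sq_ne_top {α : Type*} [MeasurableSpace α] {m : Measure α}
    {g : α → ℝ} (hg : AEStronglyMeasurable g m)
    (h : ∫⁻ x, ENNReal.ofReal (g x ^ 2) ∂m ≠ ∞) : MemLp g 2 m := by
  rw [memLp_two_iff_integrable_sq hg]
  refine ⟨hg.pow 2, ?_⟩
  rw [hasFiniteIntegral_iff_ofReal (ae_of_all _ fun _ => sq_nonneg _)]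
  exact h.lt_top

/-- Cauchy–Schwarz for the increment of a function, with no integrability assumption. -/
theorem ofReal_sq_sub_le_lintegral_sq_deriv {φ φ' : ℝ → ℝ} {a b : ℝ} (hab : a < b)
    (hc : ContinuousOn φ (Icc a b)) (hd : ∀ x ∈ Ioo a b, HasDerivWithinAt φ (φ' x) (Ioi x) x)
    (hm : Measurable φ') :
    ENNReal.ofReal ((φ b - φ a) ^ 2) ≤
      ENNReal.ofReal (b - a) * ∫⁻ r in Ioc a b, ENNReal.ofReal (φ' r ^ 2) := by
  by_cases htop : ∫⁻ r in Ioc a b, ENNReal.ofReal (φ' r ^ 2) = ∞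
  · rw [htop, ENNReal.mul_top (ENNReal.ofReal_pos.2 (sub_pos.2 hab)).ne']
    exact le_top
  have h2 : MemLp φ' 2 (volume.restrict (Ioc a b)) :=
    memLp_two_of_lintegral_sq_ne_top hm.aestronglyMeasurable htop
  have hi : IntervalIntegrable φ' volume a b :=
    (intervalIntegrable_iff_integrableOn_Ioc_of_le hab.le).2 (h2.integrable (by norm_num))
  have hftc := intervalIntegral.integral_eq_sub_of_hasDeriv_right
    (by rwa [uIcc_of_le hab.le]) (by rwa [min_eq_left hab.le, max_eq_right hab.le]) hi
  rw [← hftc, intervalIntegral.integral_of_le hab.le,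
    ← ofReal_integral_eq_lintegral_ofReal h2.integrable_sq (ae_of_all _ fun _ => sq_nonneg _),
    ← ENNReal.ofReal_mul (sub_nonneg.2 hab.le)]
  refine ENNReal.ofReal_le_ofReal ((sq_integral_le_mul_integral_sq h2).trans (le_of_eq ?_))
  simp [Measure.real, hab.le]

/-- Almost everywhere convergence together with a bound on the second moments gives convergence of
the means. -/
theorem tendsto_integral_of_lintegral_sq_le {α ι : Type*} [MeasurableSpace α] {m : Measure α}
    [IsFiniteMeasure m] {l : Filter ι} [l.IsCountablyGenerated] {g : ι → α → ℝ} {G : α → ℝ} {C : ℝ≥0}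
    (hgm : ∀ᶠ i in l, AEStronglyMeasurable (g i) m)
    (hg : ∀ᶠ i in l, ∫⁻ x, ENNReal.ofReal (g i x ^ 2) ∂m ≤ C)
    (hGm : AEStronglyMeasurable G m) (hG : ∫⁻ x, ENNReal.ofReal (G x ^ 2) ∂m ≤ C)
    (hlim : ∀ᵐ x ∂m, Tendsto (fun i => g i x) l (𝓝 (G x))) :
    Tendsto (fun i => ∫ x, g i x ∂m) l (𝓝 (∫ x, G x ∂m)) := by
  -- truncation at level `R` changes each mean by at most `C / R`
  set τ : ℝ → ℝ → ℝ := fun R y => max (-R) (min y R) with hτ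
  have hτc : ∀ R, Continuous (τ R) := fun R => by fun_prop
  have hτb : ∀ R, 0 < R → ∀ y, |τ R y| ≤ R := fun R hR y => by
    rw [abs_le]
    exact ⟨le_max_left _ _, max_le (by linarith) (min_le_right _ _)⟩
  have hτd : ∀ R, 0 < R → ∀ y, |y - τ R y| ≤ y ^ 2 / R := fun R hR y => by
    rw [le_div_iff₀ hR]
    simp only [hτ]
    rcases le_total y R with h1 | h1
    · rw [min_eq_left h1]
      rcases le_total (-R) y with h2 | h2
      · rw [max_eq_right h2]; simpa using sq_nonneg y
      · rw [max_eq_left h2, abs_of_nonpos (by linarith)]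
        nlinarith
    · rw [min_eq_right h1, max_eq_right (by linarith), abs_of_nonneg (by linarith)]
      nlinarith
  have htail : ∀ R, 0 < R → ∀ f : α → ℝ, AEStronglyMeasurable f m →
      ∫⁻ x, ENNReal.ofReal (f x ^ 2) ∂m ≤ C → |∫ x, f x ∂m - ∫ x, τ R (f x) ∂m| ≤ C / R := by
    intro R hR f hfm hf
    have h2 := memLp_two_of_lintegral_sq_ne_top hfm (hf.trans_lt ENNReal.coe_lt_top).ne
    have hτi : Integrable (fun x => τ R (f x)) m :=
      Integrable.of_bound ((hτc R).comp_aestronglyMeasurable hfm) R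
        (ae_of_all _ fun x => hτb R hR (f x))
    rw [← integral_sub (h2.integrable (by norm_num)) hτi]
    rw [← Real.norm_eq_abs]
    refine (norm_integral_le_integral_norm _).trans ?_
    calc ∫ x, ‖f x - τ R (f x)‖ ∂m ≤ ∫ x, f x ^ 2 / R ∂m :=
          integral_mono_of_nonneg (ae_of_all _ fun _ => norm_nonneg _) (h2.integrable_sq.div_const R)
            (ae_of_all _ fun x => hτd R hR (f x))
      _ = (∫ x, f x ^ 2 ∂m) / R := integral_div _ _
      _ ≤ C / R := by
          gcongr
          refine (ENNReal.ofReal_le_ofReal_iff C.coe_nonneg).1 ?_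
          rw [ofReal_integral_eq_lintegral_ofReal h2.integrable_sq
            (ae_of_all _ fun _ => sq_nonneg _), ENNReal.ofReal_coe_nnreal]
          exact hf
  rw [Metric.tendsto_nhds]
  intro ε hε
  obtain ⟨R, hR, hRε⟩ : ∃ R : ℝ, 0 < R ∧ C / R < ε / 3 := by
    refine ⟨3 * (C + 1) / ε, by positivity, ?_⟩
    rw [div_div_eq_mul_div, div_lt_iff₀ (by positivity)]
    nlinarith [C.2]
  have hτlim : Tendsto (fun i => ∫ x, τ R (g i x) ∂m) l (𝓝 (∫ x, τ R (G x) ∂m)) := by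
    refine tendsto_integral_filter_of_dominated_convergence (fun _ => R) ?_ ?_
      (integrable_const _) ?_
    · exact hgm.mono fun i hi => (hτc R).comp_aestronglyMeasurable hi
    · exact Eventually.of_forall fun i => ae_of_all _ fun x => hτb R hR _
    · exact hlim.mono fun x hx => ((hτc R).tendsto _).comp hx
  filter_upwards [hgm, hg, (Metric.tendsto_nhds.1 hτlim) (ε / 3) (by positivity)] with i h1 h2 h3
  have h4 := htail R hR (g i) h1 h2
  have h5 := htail R hR G hGm hG
  rw [Real.dist_eq] at h3 ⊢
  rw [abs_lt] at h3 ⊢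
  rw [abs_le] at h4 h5
  constructor <;> linarith [h3.1, h3.2, h4.1, h4.2, h5.1, h5.2]

variable {Ω : Type*} [MeasurableSpace Ω] {m : Measure Ω} {h h' : ℝ → Ω → ℝ}

/-- A process whose paths are differentiable has, off a null set, a version of its derivative that
is jointly measurable in time and randomness. -/
theorem exists_measurable_derivative (hmeas : ∀ s, 0 ≤ s → Measurable (h s))
    (hder : ∀ᵐ ω ∂m, ∀ s, 0 ≤ s → HasDerivWithinAt (fun r => h r ω) (h' s ω) (Ici 0) s) :
    ∃ g' : ℝ → Ω → ℝ, Measurable (Function.uncurry g') ∧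
      ∀ᵐ ω ∂m, ∀ s, 0 ≤ s → g' s ω = h' s ω := by
  classical
  obtain ⟨N, hNsub, hNm, hN0⟩ := exists_measurable_superset_of_null (ae_iff.1 hder)
  have hgood : ∀ ω, ω ∉ N → ∀ s, 0 ≤ s → HasDerivWithinAt (fun r => h r ω) (h' s ω) (Ici 0) s :=
    fun ω hω => by
      by_contra hcon
      exact hω (hNsub hcon)
  set g : ℝ → Ω → ℝ := fun s ω => if ω ∈ N then 0 else h (max s 0) ω with hg
  have hgm : Measurable (Function.uncurry g) := by
    refine measurable_uncurry_of_continuous_of_measurable (fun ω => ?_) fun s => ?_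
    · by_cases hω : ω ∈ N
      · simp only [hg, hω, if_true]; exact continuous_const
      · simp only [hg, hω, if_false]
        have hc : ContinuousOn (fun r => h r ω) (Ici 0) := fun s hs =>
          (hgood ω hω s hs).continuousWithinAt
        exact hc.comp_continuous (by fun_prop) fun s => le_max_right s 0
    · exact Measurable.ite hNm measurable_const (hmeas _ (le_max_right s 0))
  set g' : ℝ → Ω → ℝ := fun s ω => if ω ∈ N then 0 else if s < 0 then 0 else h' s ω with hg'
  refine ⟨g', ?_, ?_⟩
  · refine measurable_of_tendsto_metrizable (f := fun (k : ℕ) (p : ℝ × Ω) =>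
      ((k : ℝ) + 1) * (g (p.1 + 1 / ((k : ℝ) + 1)) p.2 - g p.1 p.2)) (fun k => ?_) ?_
    · have h1 : Measurable fun p : ℝ × Ω => g (p.1 + 1 / ((k : ℝ) + 1)) p.2 :=
        hgm.comp ((measurable_fst.add_const _).prodMk measurable_snd)
      exact (h1.sub hgm).const_mul _
    · rw [tendsto_pi_nhds]
      rintro ⟨s, ω⟩
      simp only [Function.uncurry, hg, hg']
      by_cases hω : ω ∈ N
      · simp [hω]
      simp only [hω, if_false]
      have hto0 : Tendsto (fun k : ℕ => s + 1 / ((k : ℝ) + 1)) atTop (𝓝 s) := by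
        simpa using tendsto_one_div_add_atTop_nhds_zero_nat.const_add s
      rcases lt_or_ge s 0 with hs | hs
      · simp only [hs, if_true]
        refine tendsto_const_nhds.congr' ?_
        filter_upwards [hto0.eventually (gt_mem_nhds hs)] with k hk
        rw [max_eq_right hk.le, max_eq_right hs.le, sub_self, mul_zero]
      · simp only [not_lt.2 hs, if_false]
        have hslope := hasDerivWithinAt_iff_tendsto_slope.1 (hgood ω hω s hs)
        have hto : Tendsto (fun k : ℕ => s + 1 / ((k : ℝ) + 1)) atTop (𝓝[Ici 0 \ {s}] s) := by
          refine tendsto_nhdsWithin_iff.2 ⟨hto0, Eventually.of_forall fun k => ?_⟩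
          have : 0 < 1 / ((k : ℝ) + 1) := by positivity
          exact ⟨by simp only [mem_Ici]; linarith, by simp only [mem_singleton_iff]; linarith⟩
        refine (hslope.comp hto).congr fun k => ?_
        have : 0 < 1 / ((k : ℝ) + 1) := by positivity
        simp only [Function.comp, slope_def_field]
        rw [max_eq_left (by linarith), max_eq_left hs]
        field_simp
        ring
  · filter_upwards [measure_eq_zero_iff_ae_notMem.1 hN0] with ω hω s hs
    simp [hg', hω, not_lt.2 hs]

variable {t : ℝ} {C : ℝ≥0}

theorem lintegral_sq_increment_le [IsFiniteMeasure m] (hmeas : ∀ s, 0 ≤ s → Measurable (h s))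
    (hder : ∀ᵐ ω ∂m, ∀ s, 0 ≤ s → HasDerivWithinAt (fun r => h r ω) (h' s ω) (Ici 0) s)
    {a b : ℝ} (ha : 0 ≤ a) (hab : a < b)
    (hC : ∀ s ∈ Icc a b, ∫⁻ ω, ENNReal.ofReal (h' s ω ^ 2) ∂m ≤ C) :
    ∫⁻ ω, ENNReal.ofReal ((h b ω - h a ω) ^ 2) ∂m ≤ ENNReal.ofReal ((b - a) ^ 2) * C := by
  obtain ⟨g', hg'm, hg'⟩ := exists_measurable_derivative hmeas hder
  have hsq : Measurable (Function.uncurry fun (ω : Ω) (r : ℝ) => ENNReal.ofReal (g' r ω ^ 2)) :=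
    ((hg'm.comp measurable_swap).pow_const 2).ennreal_ofReal
  calc ∫⁻ ω, ENNReal.ofReal ((h b ω - h a ω) ^ 2) ∂m
      ≤ ∫⁻ ω, (ENNReal.ofReal (b - a) * ∫⁻ r in Ioc a b, ENNReal.ofReal (g' r ω ^ 2)) ∂m := by
        refine lintegral_mono_ae ?_
        filter_upwards [hder, hg'] with ω h1 h2
        refine ofReal_sq_sub_le_lintegral_sq_deriv (φ := fun r => h r ω) hab ?_ ?_
          (hg'm.comp measurable_prodMk_right)
        · exact fun s hs => (h1 s (ha.trans hs.1)).continuousWithinAt.mono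
            (Icc_subset_Ici_self.trans (Ici_subset_Ici.2 ha))
        · intro s hs
          have hs0 : 0 ≤ s := ha.trans hs.1.le
          simp only [h2 s hs0]
          exact (h1 s hs0).mono fun r hr => hs0.trans (le_of_lt hr)
    _ = ENNReal.ofReal (b - a) * ∫⁻ r in Ioc a b, ∫⁻ ω, ENNReal.ofReal (g' r ω ^ 2) ∂m := by
        rw [lintegral_const_mul (f := fun ω => ∫⁻ r in Ioc a b, ENNReal.ofReal (g' r ω ^ 2)) _
          hsq.lintegral_prod_right', lintegral_lintegral_swap hsq.aemeasurable]
    _ ≤ ENNReal.ofReal (b - a) * ∫⁻ _ in Ioc a b, (C : ℝ≥0∞) := by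
        gcongr ENNReal.ofReal (b - a) * ?_
        refine setLIntegral_mono measurable_const fun r hr => ?_
        refine le_trans (le_of_eq (lintegral_congr_ae ?_)) (hC r ⟨hr.1.le, hr.2⟩)
        filter_upwards [hg'] with ω hω
        rw [hω r (ha.trans hr.1.le)]
    _ = ENNReal.ofReal ((b - a) ^ 2) * C := by
        rw [setLIntegral_const, Real.volume_Ioc, sq, ENNReal.ofReal_mul (sub_nonneg.2 hab.le)]
        ring

theorem eventually_lintegral_sq_increment_le [IsFiniteMeasure m] (ht : 0 ≤ t)
    (hmeas : ∀ s, 0 ≤ s → Measurable (h s))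
    (hder : ∀ᵐ ω ∂m, ∀ s, 0 ≤ s → HasDerivWithinAt (fun r => h r ω) (h' s ω) (Ici 0) s)
    (hC : ∀ᶠ s in 𝓝[Ici 0] t, ∫⁻ ω, ENNReal.ofReal (h' s ω ^ 2) ∂m ≤ C) :
    ∀ᶠ s in 𝓝[Ici 0] t, ∫⁻ ω, ENNReal.ofReal ((h s ω - h t ω) ^ 2) ∂m ≤
      ENNReal.ofReal ((s - t) ^ 2) * C := by
  obtain ⟨ε, hε, hball⟩ := Metric.mem_nhdsWithin_iff.1 hC
  filter_upwards [inter_mem_nhdsWithin (Ici 0) (Metric.ball_mem_nhds t hε)] with s hs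
  have hs0 : 0 ≤ s := hs.1
  have hs1 : |s - t| < ε := hs.2
  have hmem : ∀ r ∈ Icc (min s t) (max s t), r ∈ Metric.ball t ε := fun r hr => by
    rw [Metric.mem_ball, Real.dist_eq]
    refine lt_of_le_of_lt ?_ hs1
    rcases le_total s t with hst | hst
    · rw [min_eq_left hst, max_eq_right hst] at hr
      rw [abs_of_nonpos (by linarith [hr.2]), abs_of_nonpos (by linarith)]
      linarith [hr.1]
    · rw [min_eq_right hst, max_eq_left hst] at hr
      rw [abs_of_nonneg (by linarith [hr.1]), abs_of_nonneg (by linarith)]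
      linarith [hr.2]
  rcases lt_trichotomy s t with hst | rfl | hst
  · rw [min_eq_left hst.le, max_eq_right hst.le] at hmem
    have := lintegral_sq_increment_le hmeas hder hs0 hst fun r hr =>
      hball ⟨hmem r hr, hs0.trans hr.1⟩
    simpa only [sub_sq_comm] using this
  · simp
  · rw [min_eq_right hst.le, max_eq_left hst.le] at hmem
    exact lintegral_sq_increment_le hmeas hder ht hst fun r hr =>
      hball ⟨hmem r hr, ht.trans hr.1⟩

theorem aestronglyMeasurable_derivative (ht : 0 ≤ t) (hmeas : ∀ s, 0 ≤ s → Measurable (h s))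
    (hder : ∀ᵐ ω ∂m, ∀ s, 0 ≤ s → HasDerivWithinAt (fun r => h r ω) (h' s ω) (Ici 0) s) :
    AEStronglyMeasurable (h' t) m := by
  obtain ⟨g', hg'm, hg'⟩ := exists_measurable_derivative hmeas hder
  refine ⟨g' t, (hg'm.comp measurable_prodMk_left).stronglyMeasurable, ?_⟩
  filter_upwards [hg'] with ω hω
  rw [hω t ht]

theorem memLp_two_derivative (ht : 0 ≤ t)
    (hmeas : ∀ s, 0 ≤ s → Measurable (h s))
    (hder : ∀ᵐ ω ∂m, ∀ s, 0 ≤ s → HasDerivWithinAt (fun r => h r ω) (h' s ω) (Ici 0) s)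
    (hC : ∀ᶠ s in 𝓝[Ici 0] t, ∫⁻ ω, ENNReal.ofReal (h' s ω ^ 2) ∂m ≤ C) :
    MemLp (h' t) 2 m :=
  memLp_two_of_lintegral_sq_ne_top (aestronglyMeasurable_derivative ht hmeas hder)
    ((hC.self_of_nhdsWithin ht).trans_lt ENNReal.coe_lt_top).ne

theorem eventually_integrable_increment [IsFiniteMeasure m] (ht : 0 ≤ t)
    (hmeas : ∀ s, 0 ≤ s → Measurable (h s))
    (hder : ∀ᵐ ω ∂m, ∀ s, 0 ≤ s → HasDerivWithinAt (fun r => h r ω) (h' s ω) (Ici 0) s)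
    (hC : ∀ᶠ s in 𝓝[Ici 0] t, ∫⁻ ω, ENNReal.ofReal (h' s ω ^ 2) ∂m ≤ C) :
    ∀ᶠ s in 𝓝[Ici 0] t, Integrable (fun ω => h s ω - h t ω) m := by
  filter_upwards [eventually_lintegral_sq_increment_le ht hmeas hder hC, self_mem_nhdsWithin]
    with s hs hs0
  refine (memLp_two_of_lintegral_sq_ne_top
    ((hmeas s hs0).sub (hmeas t ht)).aestronglyMeasurable (hs.trans_lt ?_).ne).integrable
      (by norm_num)
  exact ENNReal.mul_lt_top ENNReal.ofReal_lt_top ENNReal.coe_lt_top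

/-- Differentiation under the expectation along paths with locally bounded second moments of the
velocity. -/
theorem tendsto_integral_slope [IsFiniteMeasure m] (ht : 0 ≤ t)
    (hmeas : ∀ s, 0 ≤ s → Measurable (h s))
    (hder : ∀ᵐ ω ∂m, ∀ s, 0 ≤ s → HasDerivWithinAt (fun r => h r ω) (h' s ω) (Ici 0) s)
    (hC : ∀ᶠ s in 𝓝[Ici 0] t, ∫⁻ ω, ENNReal.ofReal (h' s ω ^ 2) ∂m ≤ C) :
    Tendsto (fun s => ∫ ω, (h s ω - h t ω) / (s - t) ∂m) (𝓝[Ici 0 \ {t}] t)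
      (𝓝 (∫ ω, h' t ω ∂m)) := by
  have hle : 𝓝[Ici 0 \ {t}] t ≤ 𝓝[Ici 0] t := nhdsWithin_mono _ sdiff_subset
  refine tendsto_integral_of_lintegral_sq_le (C := C) ?_ ?_
    (aestronglyMeasurable_derivative ht hmeas hder) (hC.self_of_nhdsWithin ht) ?_
  · filter_upwards [self_mem_nhdsWithin] with s hs
    exact (((hmeas s hs.1).sub (hmeas t ht)).div_const _).aestronglyMeasurable
  · filter_upwards [self_mem_nhdsWithin,
      hle (eventually_lintegral_sq_increment_le ht hmeas hder hC)] with s hs hs2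
    have hst : 0 < (s - t) ^ 2 := by
      have : s - t ≠ 0 := sub_ne_zero.2 hs.2
      positivity
    calc ∫⁻ ω, ENNReal.ofReal (((h s ω - h t ω) / (s - t)) ^ 2) ∂m
        = ∫⁻ ω, ENNReal.ofReal ((s - t) ^ 2)⁻¹ * ENNReal.ofReal ((h s ω - h t ω) ^ 2) ∂m := by
          refine lintegral_congr fun ω => ?_
          rw [← ENNReal.ofReal_mul (by positivity), div_pow, div_eq_inv_mul]
      _ = ENNReal.ofReal ((s - t) ^ 2)⁻¹ * ∫⁻ ω, ENNReal.ofReal ((h s ω - h t ω) ^ 2) ∂m :=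
          lintegral_const_mul _
            (((hmeas s hs.1).sub (hmeas t ht)).pow_const 2).ennreal_ofReal
      _ ≤ ENNReal.ofReal ((s - t) ^ 2)⁻¹ * (ENNReal.ofReal ((s - t) ^ 2) * C) := by
          gcongr
      _ = C := by
          rw [← mul_assoc, ← ENNReal.ofReal_mul (by positivity), inv_mul_cancel₀ hst.ne',
            ENNReal.ofReal_one, one_mul]
  · filter_upwards [hder] with ω hω
    refine (hasDerivWithinAt_iff_tendsto_slope.1 (hω t ht)).congr fun s => ?_
    rw [slope_def_field]

end Increments

/-! ### The deviation and its derivative -/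

section Deviation

variable {F Z : Type*} [NormedAddCommGroup F] [InnerProductSpace ℝ F]

/-- The metric Lipschitz condition bounds the derivative of the deviation on the range of `A`. -/
theorem IsLipschitz.sq_fderiv_le {A : F → F →L[ℝ] F} {Δ : F → Z → ℝ} {L : ℝ≥0}
    (hL : IsLipschitz A Δ L) (hA : ∀ f, (A f).IsPositive)
    (hd : ∀ z, Differentiable ℝ fun f => Δ f z) (f : F) (z : Z) (u : F) :
    fderiv ℝ (fun g => Δ g z) f (A f u) ^ 2 ≤ (L : ℝ) ^ 2 * ⟪u, A f u⟫ := by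
  set v := A f u with hv
  have hq0 : 0 ≤ ⟪u, v⟫ := inner_map_nonneg (hA f) u
  rcases hq0.eq_or_lt with hq | hq
  · have : v = 0 := map_eq_zero_of_inner_eq_zero (hA f) hq.symm
    simp [this]
  set N : ℝ := √⟪u, v⟫ with hN
  have hN0 : 0 < N := Real.sqrt_pos.2 hq
  have hN2 : N ^ 2 = ⟪u, v⟫ := Real.sq_sqrt hq0
  suffices h : |fderiv ℝ (fun g => Δ g z) f v| ≤ L * N by
    rw [← hN2, ← mul_pow, ← sq_abs]
    exact pow_le_pow_left₀ (abs_nonneg _) h 2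
  have hslope : Tendsto (fun s : ℝ => s⁻¹ * (Δ (f + s • v) z - Δ f z)) (𝓝[>] 0)
      (𝓝 (fderiv ℝ (fun g => Δ g z) f v)) := by
    have h1 : HasDerivAt (fun s : ℝ => Δ (f + s • v) z) (fderiv ℝ (fun g => Δ g z) f v) 0 := by
      have h2 : HasDerivAt (fun s : ℝ => f + s • v) v 0 := by
        simpa using ((hasDerivAt_id (0 : ℝ)).smul_const v).const_add f
      have h3 : HasFDerivAt (fun g => Δ g z) (fderiv ℝ (fun g => Δ g z) f) (f + (0 : ℝ) • v) := by
        simpa using (hd z f).hasFDerivAt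
      exact h3.comp_hasDerivAt (0 : ℝ) h2
    have h4 := (hasDerivAt_iff_tendsto_slope.1 h1).mono_left
      (nhdsWithin_mono (0 : ℝ) (fun s hs => (ne_of_gt hs : s ≠ 0)) : 𝓝[>] (0 : ℝ) ≤ 𝓝[≠] 0)
    refine h4.congr fun s => ?_
    rw [slope_def_field]
    simp [div_eq_inv_mul]
  have hmain : ∀ L' : ℝ≥0, L < L' → |fderiv ℝ (fun g => Δ g z) f v| ≤ L' * N := by
    intro L' hL'
    have hev := eventually_lt_of_limsup_lt ((hL f z).trans_lt (ENNReal.coe_lt_coe.2 hL'))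
    -- the displacement `(ρ / N) v` has local norm at most `ρ`
    have hle : ∀ᶠ ρ : ℝ in 𝓝[>] 0, |(ρ / N)⁻¹ * (Δ (f + (ρ / N) • v) z - Δ f z)| ≤ L' * N := by
      filter_upwards [hev, self_mem_nhdsWithin] with ρ hρ hρ0
      have hρ0' : 0 < ρ := hρ0
      have hloc : localNorm (A f) (f + (ρ / N) • v - f) ≤ ENNReal.ofReal ρ := by
        refine (iInf₂_le ((ρ / N) • u) (by simp [hv])).trans (ENNReal.ofReal_le_ofReal ?_)
        rw [add_sub_cancel_left, inner_smul_left, inner_smul_right, real_inner_comm, ← hN2,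
          RCLike.conj_to_real]
        refine (Real.sqrt_le_left hρ0'.le).2 (le_of_eq ?_)
        field_simp
      have h5 := (le_iSup₂ (f := fun (g : F) (_ : localNorm (A f) (g - f) ≤ ENNReal.ofReal ρ) =>
        ENNReal.ofReal |Δ g z - Δ f z| / ENNReal.ofReal ρ) _ hloc).trans hρ.le
      rw [← ENNReal.ofReal_div_of_pos hρ0', ← ENNReal.ofReal_coe_nnreal] at h5
      have h6 := (div_le_iff₀ hρ0').1 ((ENNReal.ofReal_le_ofReal_iff L'.coe_nonneg).1 h5)
      rw [abs_mul, abs_of_pos (by positivity), inv_div, div_mul_eq_mul_div, div_le_iff₀ hρ0']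
      nlinarith
    have hto : Tendsto (fun ρ : ℝ => ρ / N) (𝓝[>] 0) (𝓝[>] 0) := by
      refine tendsto_nhdsWithin_iff.2 ⟨?_, ?_⟩
      · have : Tendsto (fun ρ : ℝ => ρ / N) (𝓝 0) (𝓝 (0 / N)) := tendsto_id.div_const N
        rw [zero_div] at this
        exact this.mono_left nhdsWithin_le_nhds
      · filter_upwards [self_mem_nhdsWithin] with ρ hρ
        exact div_pos hρ hN0
    exact le_of_tendsto (hslope.comp hto).abs hle
  refine le_of_forall_pos_le_add fun ε hε => ?_
  have h6 := hmain (L + (ε / N).toNNReal)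
    (lt_add_of_pos_right _ (Real.toNNReal_pos.2 (by positivity)))
  rw [NNReal.coe_add, add_mul, Real.coe_toNNReal _ (by positivity), div_mul_cancel₀ _ hN0.ne'] at h6
  exact h6

theorem measurable_fderiv_apply [MeasurableSpace Z] [MeasurableSpace F] [BorelSpace F]
    [TopologicalSpace.SeparableSpace F] {Δ : F → Z → ℝ} (hm : Measurable (Function.uncurry Δ))
    (hd : ∀ z, Differentiable ℝ fun f => Δ f z) {α : Type*} [MeasurableSpace α] {f v : α → F}
    {z : α → Z} (hf : Measurable f) (hz : Measurable z) (hv : Measurable v) :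
    Measurable fun a => fderiv ℝ (fun g => Δ g (z a)) (f a) (v a) := by
  have : SecondCountableTopology F := UniformSpace.secondCountable_of_separable F
  refine measurable_of_tendsto_metrizable (f := fun (k : ℕ) (a : α) =>
    ((k : ℝ) + 1) * (Δ (f a + (1 / ((k : ℝ) + 1)) • v a) (z a) - Δ (f a) (z a))) (fun k => ?_) ?_
  · have h1 : Measurable fun a => Δ (f a + (1 / ((k : ℝ) + 1)) • v a) (z a) :=
      hm.comp ((hf.add (hv.const_smul _)).prodMk hz)
    exact (h1.sub (hm.comp (hf.prodMk hz))).const_mul _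
  · rw [tendsto_pi_nhds]
    intro a
    have h1 : HasDerivAt (fun s : ℝ => Δ (f a + s • v a) (z a))
        (fderiv ℝ (fun g => Δ g (z a)) (f a) (v a)) 0 := by
      have h2 : HasDerivAt (fun s : ℝ => f a + s • v a) (v a) 0 := by
        simpa using ((hasDerivAt_id (0 : ℝ)).smul_const (v a)).const_add (f a)
      have h3 : HasFDerivAt (fun g => Δ g (z a)) (fderiv ℝ (fun g => Δ g (z a)) (f a))
          (f a + (0 : ℝ) • v a) := by
        simpa using (hd (z a) (f a)).hasFDerivAt
      exact h3.comp_hasDerivAt (0 : ℝ) h2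
    have hto : Tendsto (fun k : ℕ => 1 / ((k : ℝ) + 1)) atTop (𝓝[≠] 0) :=
      tendsto_nhdsWithin_iff.2 ⟨tendsto_one_div_add_atTop_nhds_zero_nat,
        Eventually.of_forall fun k => (by positivity : (1 : ℝ) / ((k : ℝ) + 1) ≠ 0)⟩
    refine ((hasDerivAt_iff_tendsto_slope.1 h1).comp hto).congr fun k => ?_
    simp only [Function.comp, slope_def_field]
    simp [div_eq_mul_inv, mul_comm]

end Deviation

section Mean

variable {F Z : Type*} [MeasurableSpace Z] {P : Measure Z} [IsProbabilityMeasure P] {ℓ : F → Z → ℝ}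

theorem integrable_deviation (hℓ : ∀ f, Integrable (ℓ f) P) (f : F) :
    Integrable (deviation P ℓ f) P :=
  (integrable_const _).sub (hℓ f)

theorem integral_deviation (hℓ : ∀ f, Integrable (ℓ f) P) (f : F) :
    ∫ z, deviation P ℓ f z ∂P = 0 := by
  simp only [deviation]
  rw [integral_sub (integrable_const _) (hℓ f), integral_const, probReal_univ, one_smul, risk,
    sub_self]

theorem integral_empirical {n : ℕ} (S : Fin n → Z) {g : Z → ℝ} (hg : Measurable g) :
    ∫ z, g z ∂(empirical S) = (n : ℝ)⁻¹ * ∑ i, g (S i) := by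
  rw [empirical, integral_smul_measure, integral_finsetSum_measure fun i _ =>
    integrable_dirac' hg.stronglyMeasurable (by simp)]
  simp only [integral_dirac' _ _ hg.stronglyMeasurable]
  simp

end Mean

/-! ### Differentiation along a posterior flow -/

section Flow

namespace PosteriorFlow

variable {F Ω₀ : Type*} [NormedAddCommGroup F] [InnerProductSpace ℝ F]
  [MeasurableSpace F] [MeasurableSpace Ω₀]

instance (ξ : PosteriorFlow F Ω₀) : IsProbabilityMeasure ξ.base := by
  have := ξ.prob_Q₀
  have := ξ.prob_P₀
  unfold base
  infer_instance

theorem isProbabilityMeasure_law (ξ : PosteriorFlow F Ω₀) {t : ℝ} (ht : 0 ≤ t) :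
    IsProbabilityMeasure (ξ.law t) :=
  Measure.isProbabilityMeasure_map (ξ.measurable_sol t ht).aemeasurable

theorem ae_hasDerivWithinAt_comp_sol (ξ : PosteriorFlow F Ω₀) :
    ∀ᵐ x ∂ξ.base, ∀ {Ψ : F → ℝ}, Differentiable ℝ Ψ → ∀ s, 0 ≤ s →
      HasDerivWithinAt (fun r => Ψ (ξ.sol r x)) (fderiv ℝ Ψ (ξ.sol s x) (ξ.velocity s x))
        (Ici 0) s := by
  filter_upwards [ξ.isSolution] with x hx Ψ hΨ s hs
  exact (hΨ (ξ.sol s x)).hasFDerivAt.comp_hasDerivWithinAt s (hx.2 s hs)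

variable [CompleteSpace F] {A : F → F →L[ℝ] F} {l : ℝ}

theorem ofReal_sq_apply_velocity_le (ξ : PosteriorFlow F Ω₀) (hA : ∀ f, (A f).IsPositive)
    (hl0 : 0 < l) {s : ℝ} {x : F × Ω₀} {Y : F →L[ℝ] ℝ}
    (hl : ∀ u, Y (A (ξ.sol s x) u) ^ 2 ≤ l ^ 2 * ⟪u, A (ξ.sol s x) u⟫) :
    ENNReal.ofReal (Y (ξ.velocity s x) ^ 2) ≤
      ENNReal.ofReal (l ^ 2) * localNorm (A (ξ.sol s x)) (ξ.velocity s x) ^ 2 :=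
  (ofReal_sq_le_dualEnergy hl0 hl _).trans
    (mul_le_mul_right (dualEnergy_le_localNorm_sq (hA _) _) _)

theorem lintegral_sq_fderiv_velocity_le (ξ : PosteriorFlow F Ω₀) (hA : ∀ f, (A f).IsPositive)
    {Ψ : F → ℝ} (hl0 : 0 < l) (hl : ∀ f u, fderiv ℝ Ψ f (A f u) ^ 2 ≤ l ^ 2 * ⟪u, A f u⟫) (s : ℝ) :
    ∫⁻ x, ENNReal.ofReal (fderiv ℝ Ψ (ξ.sol s x) (ξ.velocity s x) ^ 2) ∂ξ.base ≤
      ENNReal.ofReal (l ^ 2) * ∫⁻ x, localNorm (A (ξ.sol s x)) (ξ.velocity s x) ^ 2 ∂ξ.base := by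
  rw [← lintegral_const_mul' _ _ ENNReal.ofReal_ne_top]
  exact lintegral_mono fun x => ξ.ofReal_sq_apply_velocity_le hA hl0 (hl _)

/-- Differentiation of `s ↦ 𝔼 Ψ(f_s)`. Integrability of `Ψ` is needed at time `t` only, since the
increments of `Ψ(f_s)` are square integrable. -/
theorem hasDerivWithinAt_integral_law [TopologicalSpace.SeparableSpace F] [BorelSpace F]
    (ξ : PosteriorFlow F Ω₀) (hA : ∀ f, (A f).IsPositive)
    {Ψ : F → ℝ} (hΨ : Differentiable ℝ Ψ) (hl0 : 0 < l)
    (hl : ∀ f u, fderiv ℝ Ψ f (A f u) ^ 2 ≤ l ^ 2 * ⟪u, A f u⟫) {t : ℝ} (ht : 0 ≤ t)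
    (hE : ξ.EnergyBoundedNear A t) (hint : Integrable Ψ (ξ.law t)) :
    MemLp (fun x => fderiv ℝ Ψ (ξ.sol t x) (ξ.velocity t x)) 2 ξ.base ∧
    HasDerivWithinAt (fun s => ∫ f, Ψ f ∂(ξ.law s))
      (∫ x, fderiv ℝ Ψ (ξ.sol t x) (ξ.velocity t x) ∂ξ.base) (Ici 0) t := by
  have : SecondCountableTopology F := UniformSpace.secondCountable_of_separable F
  obtain ⟨C, hC⟩ := hE
  have hmeas : ∀ s, 0 ≤ s → Measurable fun x => Ψ (ξ.sol s x) := fun s hs =>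
    hΨ.continuous.measurable.comp (ξ.measurable_sol s hs)
  have hder : ∀ᵐ x ∂ξ.base, ∀ s, 0 ≤ s → HasDerivWithinAt (fun r => Ψ (ξ.sol r x))
      (fderiv ℝ Ψ (ξ.sol s x) (ξ.velocity s x)) (Ici 0) s := by
    filter_upwards [ξ.ae_hasDerivWithinAt_comp_sol] with x hx using hx hΨ
  have hCl : ∀ᶠ s in 𝓝[Ici 0] t, ∫⁻ x, ENNReal.ofReal
      (fderiv ℝ Ψ (ξ.sol s x) (ξ.velocity s x) ^ 2) ∂ξ.base ≤ ((l ^ 2).toNNReal * C : ℝ≥0) := by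
    filter_upwards [hC] with s hs
    rw [ENNReal.coe_mul]
    exact (ξ.lintegral_sq_fderiv_velocity_le hA hl0 hl s).trans (mul_le_mul_right hs _)
  refine ⟨memLp_two_derivative ht hmeas hder hCl, ?_⟩
  have hlaw : ∀ s, 0 ≤ s → ∫ f, Ψ f ∂(ξ.law s) = ∫ x, Ψ (ξ.sol s x) ∂ξ.base := fun s hs =>
    integral_map (ξ.measurable_sol s hs).aemeasurable hΨ.continuous.aestronglyMeasurable
  have hint_t : Integrable (fun x => Ψ (ξ.sol t x)) ξ.base :=
    (integrable_map_measure hΨ.continuous.aestronglyMeasurable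
      (ξ.measurable_sol t ht).aemeasurable).1 hint
  rw [hasDerivWithinAt_iff_tendsto_slope]
  refine (tendsto_integral_slope ht hmeas hder hCl).congr' ?_
  have hle : 𝓝[Ici 0 \ {t}] t ≤ 𝓝[Ici 0] t := nhdsWithin_mono _ sdiff_subset
  filter_upwards [self_mem_nhdsWithin, hle (eventually_integrable_increment ht hmeas hder hCl)]
    with s hs hinc
  have hint_s : Integrable (fun x => Ψ (ξ.sol s x)) ξ.base := by
    have := hinc.add hint_t
    simpa [Pi.add_def] using this
  rw [slope_def_field, hlaw s hs.1, hlaw t ht, integral_div, integral_sub hint_s hint_t]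

variable {Z : Type*} [MeasurableSpace Z] {P : Measure Z} [IsProbabilityMeasure P] {Δ : F → Z → ℝ}

/-- Along the flow, the derivative of a deviation that is centred under `P` is centred under `P`.
Differentiation and integration in `z` need not commute at an individual point `f`; they commute
here because the averaged kinetic energy is bounded near `t`. -/
theorem integral_mul_fderiv_eq_zero (ξ : PosteriorFlow F Ω₀) (hA : ∀ f, (A f).IsPositive)
    (hm : Measurable (Function.uncurry Δ)) (hd : ∀ z, Differentiable ℝ fun f => Δ f z)
    (hΔ0 : ∀ f, ∫ z, Δ f z ∂P = 0) (hΔi : ∀ f, Integrable (Δ f) P) (hl0 : 0 < l)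
    (hl : ∀ f z u, fderiv ℝ (fun g => Δ g z) f (A f u) ^ 2 ≤ l ^ 2 * ⟪u, A f u⟫)
    {t : ℝ} (ht : 0 ≤ t) (hE : ξ.EnergyBoundedNear A t) {b : F → ℝ} (hb : Measurable b)
    (hb1 : ∀ f, b f ^ 2 ≤ 1) :
    Integrable (fun p : (F × Ω₀) × Z => b (ξ.sol t p.1) *
      fderiv ℝ (fun g => Δ g p.2) (ξ.sol t p.1) (ξ.velocity t p.1)) (ξ.base.prod P) ∧
    ∫ p : (F × Ω₀) × Z, b (ξ.sol t p.1) *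
      fderiv ℝ (fun g => Δ g p.2) (ξ.sol t p.1) (ξ.velocity t p.1) ∂(ξ.base.prod P) = 0 := by
  obtain ⟨C, hC⟩ := hE
  set h : ℝ → (F × Ω₀) × Z → ℝ := fun s p => b (ξ.sol t p.1) * Δ (ξ.sol s p.1) p.2 with hh
  set h' : ℝ → (F × Ω₀) × Z → ℝ := fun s p => b (ξ.sol t p.1) *
      fderiv ℝ (fun g => Δ g p.2) (ξ.sol s p.1) (ξ.velocity s p.1) with hh'
  have hmeas : ∀ s, 0 ≤ s → Measurable (h s) := fun s hs =>
    (hb.comp ((ξ.measurable_sol t ht).comp measurable_fst)).mul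
      (hm.comp (((ξ.measurable_sol s hs).comp measurable_fst).prodMk measurable_snd))
  have hder : ∀ᵐ p ∂(ξ.base.prod P), ∀ s, 0 ≤ s →
      HasDerivWithinAt (fun r => h r p) (h' s p) (Ici 0) s := by
    filter_upwards [Measure.quasiMeasurePreserving_fst.ae ξ.ae_hasDerivWithinAt_comp_sol]
      with p hp s hs
    exact (hp (hd p.2) s hs).const_mul _
  have hCl : ∀ᶠ s in 𝓝[Ici 0] t, ∫⁻ p, ENNReal.ofReal (h' s p ^ 2) ∂(ξ.base.prod P)
      ≤ ((l ^ 2).toNNReal * C : ℝ≥0) := by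
    filter_upwards [hC] with s hs
    have hpt : ∀ (x : F × Ω₀) (z : Z), ENNReal.ofReal (h' s (x, z) ^ 2) ≤
        ENNReal.ofReal (l ^ 2) * localNorm (A (ξ.sol s x)) (ξ.velocity s x) ^ 2 := fun x z => by
      refine le_trans (ENNReal.ofReal_le_ofReal ?_)
        (ξ.ofReal_sq_apply_velocity_le hA hl0 (hl _ z))
      simp only [hh']
      rw [mul_pow]
      exact mul_le_of_le_one_left (sq_nonneg _) (hb1 _)
    calc ∫⁻ p, ENNReal.ofReal (h' s p ^ 2) ∂(ξ.base.prod P)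
        ≤ ∫⁻ x, ∫⁻ z, ENNReal.ofReal (h' s (x, z) ^ 2) ∂P ∂ξ.base := lintegral_prod_le _
      _ ≤ ∫⁻ x, ∫⁻ _, ENNReal.ofReal (l ^ 2) *
            localNorm (A (ξ.sol s x)) (ξ.velocity s x) ^ 2 ∂P ∂ξ.base :=
          lintegral_mono fun x => lintegral_mono fun z => hpt x z
      _ = ENNReal.ofReal (l ^ 2) * ∫⁻ x, localNorm (A (ξ.sol s x)) (ξ.velocity s x) ^ 2 ∂ξ.base := by
          simp only [lintegral_const, measure_univ, mul_one]
          exact lintegral_const_mul' _ _ ENNReal.ofReal_ne_top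
      _ ≤ ((l ^ 2).toNNReal * C : ℝ≥0) := by
          rw [ENNReal.coe_mul]
          exact mul_le_mul_right hs _
  refine ⟨(memLp_two_derivative ht hmeas hder hCl).integrable (by norm_num), ?_⟩
  have hle : 𝓝[Ici 0 \ {t}] t ≤ 𝓝[Ici 0] t := nhdsWithin_mono _ sdiff_subset
  have hne : (𝓝[Ici 0 \ {t}] t).NeBot :=
    (inferInstance : (𝓝[>] t).NeBot).mono (nhdsWithin_mono _ fun s hs =>
      ⟨ht.trans (le_of_lt hs), ne_of_gt hs⟩)
  refine tendsto_nhds_unique (tendsto_integral_slope ht hmeas hder hCl)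
    (tendsto_const_nhds.congr' ?_)
  filter_upwards [self_mem_nhdsWithin, hle (eventually_integrable_increment ht hmeas hder hCl)]
    with s hs hinc
  rw [integral_div, integral_prod _ hinc]
  have h0 : ∀ x, ∫ z, h s (x, z) - h t (x, z) ∂P = 0 := fun x => by
    simp only [hh]
    rw [integral_sub ((hΔi _).const_mul _) ((hΔi _).const_mul _), integral_const_mul,
      integral_const_mul, hΔ0, hΔ0]
    simp
  simp [h0]

/-- The tower property: tested against functions of `f_t`, the velocity may be replaced by the mean
flow. -/
theorem integral_inner_velocity [TopologicalSpace.SeparableSpace F] [BorelSpace F]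
    (ξ : PosteriorFlow F Ω₀) {μ : ℝ → F → F} (hμ : ξ.IsMeanFlow μ)
    {t : ℝ} (ht : 0 ≤ t) {G : F → F} (hG : Measurable G)
    (hint : Integrable (fun x => ⟪G (ξ.sol t x), ξ.velocity t x⟫) ξ.base) :
    Integrable (fun x => ⟪G (ξ.sol t x), μ t (ξ.sol t x)⟫) ξ.base ∧
    ∫ x, ⟪G (ξ.sol t x), ξ.velocity t x⟫ ∂ξ.base =
      ∫ x, ⟪G (ξ.sol t x), μ t (ξ.sol t x)⟫ ∂ξ.base := by
  have : SecondCountableTopology F := UniformSpace.secondCountable_of_separable F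
  obtain ⟨hμm, hvel, hce⟩ := hμ t ht
  have hle : MeasurableSpace.comap (ξ.sol t) inferInstance ≤
      (inferInstance : MeasurableSpace (F × Ω₀)) := (ξ.measurable_sol t ht).comap_le
  have hGm : StronglyMeasurable[MeasurableSpace.comap (ξ.sol t) inferInstance]
      fun x => G (ξ.sol t x) :=
    (hG.comp (comap_measurable (ξ.sol t))).stronglyMeasurable
  have hpull := condExp_bilin_of_stronglyMeasurable_left (innerSL ℝ) hGm hint hvel
  have hae : (ξ.base[fun x => ⟪G (ξ.sol t x), ξ.velocity t x⟫ |
      MeasurableSpace.comap (ξ.sol t) inferInstance])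
      =ᵐ[ξ.base] fun x => ⟪G (ξ.sol t x), μ t (ξ.sol t x)⟫ := by
    filter_upwards [hpull, hce] with x h1 h2
    rw [h2] at h1
    exact h1
  exact ⟨(integrable_congr hae).1 integrable_condExp,
    by rw [← integral_condExp hle]; exact integral_congr_ae hae⟩

end PosteriorFlow

end Flow

/-! ### The mean flow -/

section MeanFlow

variable {F : Type*} [NormedAddCommGroup F] [InnerProductSpace ℝ F] [CompleteSpace F]

theorem inner_gradient_left (Ψ : F → ℝ) (f v : F) : ⟪gradient Ψ f, v⟫ = fderiv ℝ Ψ f v := by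
  rw [gradient, InnerProductSpace.toDual_symm_apply]

theorem measurable_gradient [MeasurableSpace F] [BorelSpace F] (Ψ : F → ℝ) : Measurable (gradient Ψ) :=
  (InnerProductSpace.toDual ℝ F).symm.continuous.measurable.comp (measurable_fderiv ℝ Ψ)

variable [TopologicalSpace.SeparableSpace F] [MeasurableSpace F] [BorelSpace F]
  {Z : Type*} [MeasurableSpace Z] {A : F → F →L[ℝ] F} {l : ℝ}
  {P : Measure Z} [IsProbabilityMeasure P] {Δ : F → Z → ℝ}

theorem integrable_fderiv_apply (hm : Measurable (Function.uncurry Δ))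
    (hd : ∀ z, Differentiable ℝ fun f => Δ f z) (hl0 : 0 < l)
    (hl : ∀ f z u, fderiv ℝ (fun g => Δ g z) f (A f u) ^ 2 ≤ l ^ 2 * ⟪u, A f u⟫)
    {Q : Measure F} [IsProbabilityMeasure Q] {v : F → F} (hv : Measurable v)
    (hW : ∫⁻ f, dualEnergy (A f) (v f) ∂Q ≠ ∞) :
    Integrable (fun p : F × Z => fderiv ℝ (fun g => Δ g p.2) p.1 (v p.1)) (Q.prod P) := by
  have hmeas : Measurable fun p : F × Z => fderiv ℝ (fun g => Δ g p.2) p.1 (v p.1) :=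
    measurable_fderiv_apply hm hd measurable_fst measurable_snd (hv.comp measurable_fst)
  refine (memLp_two_of_lintegral_sq_ne_top hmeas.aestronglyMeasurable
    (ne_top_of_le_ne_top ?_ ((lintegral_prod_le _).trans (lintegral_mono fun f =>
      lintegral_mono fun z => ofReal_sq_le_dualEnergy hl0 (hl f z) (v f))))).integrable
      (by norm_num)
  simp only [lintegral_const, measure_univ, mul_one]
  rw [lintegral_const_mul' _ _ ENNReal.ofReal_ne_top]
  exact ENNReal.mul_ne_top ENNReal.ofReal_ne_top hW

/-- The mean flow inherits the centring of the random velocity. -/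
theorem PosteriorFlow.ae_integral_fderiv_meanFlow_eq_zero {Ω₀ : Type*} [MeasurableSpace Ω₀]
    (ξ : PosteriorFlow F Ω₀) (hA : ∀ f, (A f).IsPositive)
    (hm : Measurable (Function.uncurry Δ)) (hd : ∀ z, Differentiable ℝ fun f => Δ f z)
    (hΔ0 : ∀ f, ∫ z, Δ f z ∂P = 0) (hΔi : ∀ f, Integrable (Δ f) P) (hl0 : 0 < l)
    (hl : ∀ f z u, fderiv ℝ (fun g => Δ g z) f (A f u) ^ 2 ≤ l ^ 2 * ⟪u, A f u⟫)
    {μ : ℝ → F → F} (hμ : ξ.IsMeanFlow μ)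
    {t : ℝ} (ht : 0 ≤ t) (hE : ξ.EnergyBoundedNear A t)
    (hW : ∫⁻ f, dualEnergy (A f) (μ t f) ∂(ξ.law t) ≠ ∞) :
    ∀ᵐ f ∂(ξ.law t), ∫ z, fderiv ℝ (fun g => Δ g z) f (μ t f) ∂P = 0 := by
  have := ξ.isProbabilityMeasure_law ht
  have hμm : Measurable (μ t) := (hμ t ht).1
  have hsol := ξ.measurable_sol t ht
  have hJ := integrable_fderiv_apply (P := P) hm hd hl0 hl hμm hW
  refine hJ.integral_prod_left.ae_eq_zero_of_forall_setIntegral_eq_zero fun B hB _ => ?_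
  set b : F → ℝ := B.indicator 1 with hb
  have hbm : Measurable b := measurable_one.indicator hB
  have hb1 : ∀ f, b f ^ 2 ≤ 1 := fun f => by
    by_cases hf : f ∈ B <;> simp [hb, hf]
  obtain ⟨hI, hI0⟩ := ξ.integral_mul_fderiv_eq_zero (P := P) hA hm hd hΔ0 hΔi hl0 hl ht hE hbm hb1
  have hJb : Integrable (fun p : F × Z => b p.1 * fderiv ℝ (fun g => Δ g p.2) p.1 (μ t p.1))
      ((ξ.law t).prod P) := by
    refine hJ.mono ((hbm.comp measurable_fst).aestronglyMeasurable.mul hJ.1) (ae_of_all _ fun p => ?_)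
    rw [norm_mul]
    refine mul_le_of_le_one_left (norm_nonneg _) ?_
    rw [← sq_le_one_iff₀ (norm_nonneg _), Real.norm_eq_abs, sq_abs]
    exact hb1 _
  have hinner : ∀ z, Integrable (fun x => b (ξ.sol t x) *
      fderiv ℝ (fun g => Δ g z) (ξ.sol t x) (ξ.velocity t x)) ξ.base →
      ∫ f, b f * fderiv ℝ (fun g => Δ g z) f (μ t f) ∂(ξ.law t) =
      ∫ x, b (ξ.sol t x) * fderiv ℝ (fun g => Δ g z) (ξ.sol t x) (ξ.velocity t x) ∂ξ.base := by
    intro z hz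
    have hG : ∀ f v, ⟪b f • gradient (fun g => Δ g z) f, v⟫ = b f * fderiv ℝ (fun g => Δ g z) f v :=
      fun f v => by rw [real_inner_smul_left, inner_gradient_left]
    have h1 := (ξ.integral_inner_velocity hμ ht (G := fun f => b f • gradient (fun g => Δ g z) f)
      (hbm.smul (measurable_gradient _)) (by simpa only [hG] using hz)).2
    simp only [hG] at h1
    rw [h1]
    refine integral_map hsol.aemeasurable (hbm.mul ?_).aestronglyMeasurable
    exact measurable_fderiv_apply hm hd measurable_id measurable_const hμm
  calc ∫ f in B, ∫ z, fderiv ℝ (fun g => Δ g z) f (μ t f) ∂P ∂(ξ.law t)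
      = ∫ f, ∫ z, b f * fderiv ℝ (fun g => Δ g z) f (μ t f) ∂P ∂(ξ.law t) := by
        rw [← integral_indicator hB]
        refine integral_congr_ae (ae_of_all _ fun f => ?_)
        by_cases hf : f ∈ B <;> simp [hb, hf]
    _ = ∫ z, ∫ f, b f * fderiv ℝ (fun g => Δ g z) f (μ t f) ∂(ξ.law t) ∂P :=
        integral_integral_swap hJb
    _ = ∫ z, ∫ x, b (ξ.sol t x) *
          fderiv ℝ (fun g => Δ g z) (ξ.sol t x) (ξ.velocity t x) ∂ξ.base ∂P := by
        refine integral_congr_ae ?_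
        filter_upwards [hI.prod_left_ae] with z hz using hinner z hz
    _ = 0 := by rw [← hI0, integral_prod_symm _ hI]

end MeanFlow

/-! ### Optimisation over the grid -/

section Grid

theorem log_four_add_one_le {n : ℕ} (hn : 0 < n) :
    ((Nat.log 4 n + 1 : ℕ) : ℝ) ≤ Real.exp 1 + Real.log (2 * (n : ℝ) ^ 2) ^ 2 := by
  have hn' : (0 : ℝ) < n := by exact_mod_cast hn
  have h1 : ((4 ^ Nat.log 4 n : ℕ) : ℝ) ≤ n := by
    exact_mod_cast Nat.pow_log_le_self 4 hn.ne'
  have h2 := Real.log_le_log (by positivity) h1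
  rw [Nat.cast_pow, Real.log_pow] at h2
  have h4 : 1 ≤ Real.log 4 := by
    rw [Real.le_log_iff_exp_le (by norm_num)]
    linarith [Real.exp_one_lt_d9]
  have hlogn : 0 ≤ Real.log n := Real.log_natCast_nonneg n
  have h5 : (Nat.log 4 n : ℝ) ≤ Real.log n := by
    refine le_trans ?_ h2
    push_cast
    nlinarith [Nat.cast_nonneg (α := ℝ) (Nat.log 4 n)]
  have h6 : Real.log (2 * (n : ℝ) ^ 2) = Real.log 2 + 2 * Real.log n := by
    rw [Real.log_mul (by norm_num) (by positivity), Real.log_pow]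
    push_cast
    ring
  have h7 : 0 < Real.log 2 := Real.log_pos (by norm_num)
  rw [h6]
  push_cast
  nlinarith [Real.exp_one_gt_d9, sq_nonneg (2 * Real.log n - 1), mul_nonneg h7.le hlogn]

theorem log_le_logFactor {n : ℕ} (hn : 0 < n) :
    Real.log ((Nat.log 4 n + 1 : ℕ) : ℝ) ≤ logFactor n :=
  Real.log_le_log (by positivity) (log_four_add_one_le hn)

theorem one_le_logFactor (n : ℕ) : 1 ≤ logFactor n := by
  rw [logFactor, Real.le_log_iff_exp_le (by positivity)]
  linarith [sq_nonneg (Real.log (2 * (n : ℝ) ^ 2))]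

/-- Optimising the scale `α` and the regularisation `λ` over the geometric grid
`(3 / 4) n L² / 4ᵏ`, `k ≤ log₄ n`. Outside the range covered by the grid the bound is weaker than the
a priori estimate `d² ≤ 2 V²`. -/
theorem le_of_forall_grid_le {n : ℕ} (hn : 0 < n) {L V W K d : ℝ} (hL : 0 < L) (hV : 0 < V)
    (hW0 : 0 ≤ W) (hVW : V ≤ L * W) (hdV : d ^ 2 ≤ 2 * V ^ 2) (hK : 1 ≤ K)
    (h : ∀ k : Fin (Nat.log 4 n + 1), ∀ α : ℝ, 0 < α →
      n * α * d - n * α ^ 2 * V ^ 2 - (3 / 4 * (n * L ^ 2) / 4 ^ (k : ℕ)) * α ^ 2 / 2 * W ^ 2 ≤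
        K + n * L ^ 2 / (3 / 4 * (n * L ^ 2) / 4 ^ (k : ℕ))) :
    d ≤ 2 * V * √(K / n) + 2 * L * W / √n := by
  have hn' : (0 : ℝ) < n := by exact_mod_cast hn
  have hW : 0 < W := by
    rcases hW0.eq_or_lt with h0 | h0
    · rw [← h0, mul_zero] at hVW; linarith
    · exact h0
  set κ : ℝ := √K with hκ
  set ν : ℝ := √n with hν
  have hκ0 : 0 < κ := Real.sqrt_pos.2 (by linarith)
  have hν0 : 0 < ν := Real.sqrt_pos.2 hn'
  have hκ2 : κ ^ 2 = K := Real.sq_sqrt (by linarith)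
  have hν2 : ν ^ 2 = n := Real.sq_sqrt hn'.le
  have hκ1 : 1 ≤ κ := Real.one_le_sqrt.2 hK
  rw [Real.sqrt_div (by linarith), ← hκ, ← hν]
  by_contra hcon
  push Not at hcon
  have hA : 0 < 2 * V * (κ / ν) := by positivity
  have hB : 0 < 2 * L * W / ν := by positivity
  -- the two terms are each below `√2 V`
  have hκν : 2 * κ ^ 2 ≤ ν ^ 2 := by
    have h1 : (2 * V * (κ / ν)) ^ 2 ≤ 2 * V ^ 2 :=
      (pow_le_pow_left₀ hA.le (by linarith) 2).trans hdV
    have h2 : (2 * V * (κ / ν)) ^ 2 = (2 * V ^ 2) * (2 * κ ^ 2 / ν ^ 2) := by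
      field_simp
    rw [h2] at h1
    have h3 : 2 * κ ^ 2 / ν ^ 2 ≤ 1 := by
      by_contra h4
      push Not at h4
      nlinarith [pow_pos hV 2]
    rwa [div_le_one (by positivity)] at h3
  have hLWV : 2 * (L * W / V) ^ 2 ≤ ν ^ 2 := by
    have h1 : (2 * L * W / ν) ^ 2 ≤ 2 * V ^ 2 :=
      (pow_le_pow_left₀ hB.le (by linarith) 2).trans hdV
    rw [div_pow, div_le_iff₀ (by positivity)] at h1
    rw [div_pow, ← mul_div_assoc, div_le_iff₀ (by positivity)]
    nlinarith
  set y : ℝ := κ * (L * W / V) with hy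
  have hy1 : 1 ≤ y := one_le_mul_of_one_le_of_one_le hκ1 ((one_le_div hV).2 hVW)
  have hyn : y ≤ n := by
    rw [← hν2]
    nlinarith [sq_nonneg (κ - L * W / V), sq_nonneg ν]
  obtain ⟨k, hk1, hk2⟩ := exists_nat_pow_near hy1 (by norm_num : (1 : ℝ) < 4)
  have hkn : k < Nat.log 4 n + 1 := by
    refine Nat.lt_succ_of_le (Nat.le_log_of_pow_le (by norm_num) ?_)
    exact_mod_cast hk1.trans hyn
  have h4k : (0 : ℝ) < 4 ^ k := by positivity
  set b : ℝ := 3 / 4 * (y / 4 ^ k) with hb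
  have hb1 : 3 / 4 ≤ b := by
    have : 1 ≤ y / 4 ^ k := (one_le_div h4k).2 hk1
    rw [hb]; linarith
  have hb2 : b ≤ 3 := by
    have : y / 4 ^ k ≤ 4 := by rw [div_le_iff₀ h4k]; rw [pow_succ] at hk2; linarith
    rw [hb]; linarith
  have hb0 : 0 < b := by linarith
  have hbb : b / 2 + 1 / b ≤ 2 := by
    have h1 : 1 / b ≤ 2 - b / 2 := by
      rw [div_le_iff₀ hb0]
      nlinarith
    linarith
  have key := h ⟨k, hkn⟩ (κ / (ν * V)) (by positivity)
  simp only at key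
  -- with this scale, `λ α = (ν L / W) b`
  have e1 : (n : ℝ) * (κ / (ν * V)) * d = ν * κ / V * d := by
    rw [← hν2]; field_simp
  have e2 : (n : ℝ) * (κ / (ν * V)) ^ 2 * V ^ 2 = κ ^ 2 := by
    rw [← hν2]; field_simp
  have e3 : (3 / 4 * ((n : ℝ) * L ^ 2) / 4 ^ k) * (κ / (ν * V)) ^ 2 / 2 * W ^ 2
      = κ * L * W / V * (b / 2) := by
    rw [hb, hy, ← hν2]; field_simp
  have e4 : (n : ℝ) * L ^ 2 / (3 / 4 * (n * L ^ 2) / 4 ^ k) = κ * L * W / V * (1 / b) := by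
    rw [hb, hy, ← hν2]; field_simp
  rw [e1, e2, e3, e4, ← hκ2] at key
  have h5 : κ * L * W / V * (b / 2 + 1 / b) ≤ κ * L * W / V * 2 := by gcongr
  have h6 : ν * κ / V * d ≤ 2 * κ ^ 2 + κ * L * W / V * 2 := by linarith
  have h7 : ν * κ / V * (2 * V * (κ / ν) + 2 * L * W / ν) = 2 * κ ^ 2 + κ * L * W / V * 2 := by
    field_simp
  have h8 : ν * κ / V * (2 * V * (κ / ν) + 2 * L * W / ν) < ν * κ / V * d := by gcongr
  linarith

end Grid

/-! ### Empirical means and second moments -/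

section Empirical

theorem sq_mean_le {n : ℕ} (x : Fin n → ℝ) :
    ((n : ℝ)⁻¹ * ∑ i, x i) ^ 2 ≤ (n : ℝ)⁻¹ * ∑ i, x i ^ 2 := by
  rcases Nat.eq_zero_or_pos n with rfl | hn
  · simp
  have hn' : (0 : ℝ) < n := by exact_mod_cast hn
  have h := sq_sum_le_card_mul_sum_sq (s := Finset.univ) (f := x)
  rw [Finset.card_univ, Fintype.card_fin] at h
  calc ((n : ℝ)⁻¹ * ∑ i, x i) ^ 2 = (n : ℝ)⁻¹ ^ 2 * (∑ i, x i) ^ 2 := mul_pow _ _ _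
    _ ≤ (n : ℝ)⁻¹ ^ 2 * (n * ∑ i, x i ^ 2) := by gcongr
    _ = (n : ℝ)⁻¹ * ∑ i, x i ^ 2 := by field_simp

theorem mean_le {n : ℕ} (hn : 0 < n) {x : Fin n → ℝ} {c : ℝ} (h : ∀ i, x i ≤ c) :
    (n : ℝ)⁻¹ * ∑ i, x i ≤ c := by
  have hn' : (0 : ℝ) < n := by exact_mod_cast hn
  rw [inv_mul_le_iff₀ hn']
  simpa using Finset.sum_le_sum fun i (_ : i ∈ Finset.univ) => h i

theorem isProbabilityMeasure_empirical {Z : Type*} [MeasurableSpace Z] {n : ℕ} (hn : 0 < n)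
    (S : Fin n → Z) : IsProbabilityMeasure (empirical S) := by
  refine ⟨?_⟩
  simp only [empirical, Measure.smul_apply, Measure.coe_finsetSum, Finset.sum_apply, measure_univ,
    Finset.sum_const, Finset.card_univ, Fintype.card_fin, smul_eq_mul, nsmul_eq_mul, mul_one]
  exact ENNReal.inv_mul_cancel (by exact_mod_cast hn.ne') (ENNReal.natCast_ne_top n)

variable {F Z : Type*} [NormedAddCommGroup F] [InnerProductSpace ℝ F] [MeasurableSpace Z]
  {Δ : F → Z → ℝ}

theorem hasFDerivAt_integral_empirical (hΔ : ∀ f, Measurable (Δ f))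
    (hd : ∀ z, Differentiable ℝ fun f => Δ f z) {n : ℕ} (S : Fin n → Z) (f : F) :
    HasFDerivAt (fun f => ∫ z, Δ f z ∂(empirical S))
      ((n : ℝ)⁻¹ • ∑ i, fderiv ℝ (fun g => Δ g (S i)) f) f := by
  simp_rw [fun f => integral_empirical S (hΔ f)]
  exact (HasFDerivAt.fun_sum fun i _ => (hd (S i) f).hasFDerivAt).const_mul _

theorem fderiv_integral_empirical_apply (hΔ : ∀ f, Measurable (Δ f))
    (hd : ∀ z, Differentiable ℝ fun f => Δ f z) {n : ℕ} (S : Fin n → Z) (f v : F) :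
    fderiv ℝ (fun f => ∫ z, Δ f z ∂(empirical S)) f v =
      (n : ℝ)⁻¹ * ∑ i, fderiv ℝ (fun g => Δ g (S i)) f v := by
  rw [(hasFDerivAt_integral_empirical hΔ hd S f).fderiv]
  simp

end Empirical

section Velocity

variable {F Z : Type*} [NormedAddCommGroup F] [InnerProductSpace ℝ F] [CompleteSpace F]
  [TopologicalSpace.SeparableSpace F] [MeasurableSpace F] [BorelSpace F] [MeasurableSpace Z]

/-- The mean square of the derivative of `Δ(·, z)` at `f` along `v`, for `z` drawn from
`(P + P_S) / 2`. It is real valued, with the empirical part written out as a sum, and agrees with the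
integrand of `deviationVelocity` wherever the dual energy of `v` is finite. -/
noncomputable def meanSqDeriv (P : Measure Z) {n : ℕ} (Δ : F → Z → ℝ) (S : Fin n → Z) (f v : F) :
    ℝ :=
  (∫ z, fderiv ℝ (fun g => Δ g z) f v ^ 2 ∂P +
    (n : ℝ)⁻¹ * ∑ i, fderiv ℝ (fun g => Δ g (S i)) f v ^ 2) / 2

variable {P : Measure Z} [IsProbabilityMeasure P] {n : ℕ} {A : F → F →L[ℝ] F} {l : ℝ}
  {Δ : F → Z → ℝ}

omit [CompleteSpace F] [TopologicalSpace.SeparableSpace F] [MeasurableSpace F] [BorelSpace F]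
  [IsProbabilityMeasure P] in
theorem meanSqDeriv_nonneg (S : Fin n → Z) (f v : F) : 0 ≤ meanSqDeriv P Δ S f v := by
  have : 0 ≤ ∫ z, fderiv ℝ (fun g => Δ g z) f v ^ 2 ∂P := integral_nonneg fun _ => sq_nonneg _
  unfold meanSqDeriv
  positivity

omit [CompleteSpace F] [TopologicalSpace.SeparableSpace F] [MeasurableSpace F] [BorelSpace F]
  [IsProbabilityMeasure P] in
theorem sq_mean_fderiv_le (S : Fin n → Z) (f v : F) :
    ((n : ℝ)⁻¹ * ∑ i, fderiv ℝ (fun g => Δ g (S i)) f v) ^ 2 ≤ 2 * meanSqDeriv P Δ S f v := by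
  have : 0 ≤ ∫ z, fderiv ℝ (fun g => Δ g z) f v ^ 2 ∂P := integral_nonneg fun _ => sq_nonneg _
  unfold meanSqDeriv
  linarith [sq_mean_le fun i => fderiv ℝ (fun g => Δ g (S i)) f v]

omit [TopologicalSpace.SeparableSpace F] [MeasurableSpace F] [BorelSpace F] in
theorem meanSqDeriv_le (hn : 0 < n) (hl0 : 0 < l)
    (hl : ∀ f z u, fderiv ℝ (fun g => Δ g z) f (A f u) ^ 2 ≤ l ^ 2 * ⟪u, A f u⟫) (S : Fin n → Z)
    {f v : F} (hv : dualEnergy (A f) v ≠ ∞) :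
    meanSqDeriv P Δ S f v ≤ l ^ 2 * (dualEnergy (A f) v).toReal := by
  have h1 : ∀ z, fderiv ℝ (fun g => Δ g z) f v ^ 2 ≤ l ^ 2 * (dualEnergy (A f) v).toReal :=
    fun z => sq_le_toReal_dualEnergy hl0 (hl f z) hv
  have h2 : ∫ z, fderiv ℝ (fun g => Δ g z) f v ^ 2 ∂P ≤ l ^ 2 * (dualEnergy (A f) v).toReal := by
    refine (integral_mono_of_nonneg (ae_of_all _ fun _ => sq_nonneg _) (integrable_const _)
      (ae_of_all _ h1)).trans (le_of_eq ?_)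
    simp
  have h3 := mean_le hn fun i => h1 (S i)
  unfold meanSqDeriv
  linarith

omit [CompleteSpace F] in
theorem measurable_meanSqDeriv (hm : Measurable (Function.uncurry Δ))
    (hd : ∀ z, Differentiable ℝ fun f => Δ f z) (S : Fin n → Z) {v : F → F} (hv : Measurable v) :
    Measurable fun f => meanSqDeriv P Δ S f (v f) := by
  have h1 : Measurable fun p : F × Z => fderiv ℝ (fun g => Δ g p.2) p.1 (v p.1) ^ 2 :=
    (measurable_fderiv_apply hm hd measurable_fst measurable_snd (hv.comp measurable_fst)).pow_const 2
  have h2 : Measurable fun f => ∫ z, fderiv ℝ (fun g => Δ g z) f (v f) ^ 2 ∂P :=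
    (h1.stronglyMeasurable.integral_prod_right (ν := P)).measurable
  have h3 : ∀ i, Measurable fun f => fderiv ℝ (fun g => Δ g (S i)) f (v f) ^ 2 := fun i =>
    (measurable_fderiv_apply hm hd measurable_id measurable_const hv).pow_const 2
  exact (h2.add ((Finset.measurable_sum _ fun i _ => h3 i).const_mul _)).div_const 2

theorem ofReal_meanSqDeriv_le_lintegral (hn : 0 < n) (hm : Measurable (Function.uncurry Δ))
    (hd : ∀ z, Differentiable ℝ fun f => Δ f z) (hl0 : 0 < l)
    (hl : ∀ f z u, fderiv ℝ (fun g => Δ g z) f (A f u) ^ 2 ≤ l ^ 2 * ⟪u, A f u⟫) (S : Fin n → Z)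
    {f v : F} (hv : dualEnergy (A f) v ≠ ∞) :
    ENNReal.ofReal (meanSqDeriv P Δ S f v) ≤
      ∫⁻ z, ENNReal.ofReal (⟪v, gradient (fun g => Δ g z) f⟫ ^ 2)
        ∂((2 : ℝ≥0∞)⁻¹ • (P + empirical S)) := by
  have := isProbabilityMeasure_empirical hn S
  have hgm : Measurable fun z => fderiv ℝ (fun g => Δ g z) f v ^ 2 :=
    (measurable_fderiv_apply hm hd measurable_const measurable_id measurable_const).pow_const 2
  have hint : ∀ (m : Measure Z) [IsProbabilityMeasure m],
      Integrable (fun z => fderiv ℝ (fun g => Δ g z) f v ^ 2) m := fun m _ =>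
    Integrable.of_bound hgm.aestronglyMeasurable (l ^ 2 * (dualEnergy (A f) v).toReal)
      (ae_of_all _ fun z => by
        rw [Real.norm_of_nonneg (sq_nonneg _)]
        exact sq_le_toReal_dualEnergy hl0 (hl f z) hv)
  simp_rw [fun z => real_inner_comm (gradient (fun g => Δ g z) f) v, inner_gradient_left]
  rw [lintegral_smul_measure, lintegral_add_measure, smul_eq_mul, meanSqDeriv,
    ← integral_empirical S hgm]
  have h0 : ∀ (m : Measure Z), 0 ≤ ∫ z, fderiv ℝ (fun g => Δ g z) f v ^ 2 ∂m := fun m =>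
    integral_nonneg fun _ => sq_nonneg _
  calc ENNReal.ofReal ((∫ z, fderiv ℝ (fun g => Δ g z) f v ^ 2 ∂P +
        ∫ z, fderiv ℝ (fun g => Δ g z) f v ^ 2 ∂(empirical S)) / 2)
      = 2⁻¹ * (ENNReal.ofReal (∫ z, fderiv ℝ (fun g => Δ g z) f v ^ 2 ∂P) +
          ENNReal.ofReal (∫ z, fderiv ℝ (fun g => Δ g z) f v ^ 2 ∂(empirical S))) := by
        rw [← ENNReal.ofReal_add (h0 _) (h0 _), div_eq_inv_mul,
          ENNReal.ofReal_mul (by norm_num), ENNReal.ofReal_inv_of_pos (by norm_num)]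
        simp
    _ ≤ _ := by
        gcongr
        · exact ofReal_integral_le_lintegral (hint P)
        · exact ofReal_integral_le_lintegral (hint _)

/-- For a vector field `v` of finite energy, the mean empirical derivative and the mean square
derivative are controlled by the energy. If moreover `v` is centred, a bound on the averaged
log-weight of `α • v` is a quadratic inequality in the scale `α` between these quantities. -/
theorem integral_mean_fderiv_le (hn : 0 < n) (hm : Measurable (Function.uncurry Δ))
    (hd : ∀ z, Differentiable ℝ fun f => Δ f z) (hA_meas : ∀ u, Measurable fun f => A f u)
    (hl0 : 0 < l)
    (hl : ∀ f z u, fderiv ℝ (fun g => Δ g z) f (A f u) ^ 2 ≤ l ^ 2 * ⟪u, A f u⟫) (S : Fin n → Z)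
    {Q : Measure F} [IsProbabilityMeasure Q] {v : F → F} (hv : Measurable v)
    (hW : ∫⁻ f, dualEnergy (A f) (v f) ∂Q ≠ ∞) :
    Integrable (fun f => meanSqDeriv P Δ S f (v f)) Q ∧
    (∫ f, (n : ℝ)⁻¹ * ∑ i, fderiv ℝ (fun g => Δ g (S i)) f (v f) ∂Q) ^ 2 ≤
      2 * ∫ f, meanSqDeriv P Δ S f (v f) ∂Q ∧
    ∫ f, meanSqDeriv P Δ S f (v f) ∂Q ≤ l ^ 2 * (∫⁻ f, dualEnergy (A f) (v f) ∂Q).toReal ∧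
    ∀ K lam : ℝ, (∀ᵐ f ∂Q, ∫ z, fderiv ℝ (fun g => Δ g z) f (v f) ∂P = 0) → ∀ α : ℝ, 0 < α →
      (Integrable (fun f => logWeight P (fun z => fderiv ℝ (fun g => Δ g z) f) S (α • v f)
        - lam / 2 * (dualEnergy (A f) (α • v f)).toReal) Q →
       ∫ f, (logWeight P (fun z => fderiv ℝ (fun g => Δ g z) f) S (α • v f)
        - lam / 2 * (dualEnergy (A f) (α • v f)).toReal) ∂Q ≤ K) →
      n * α * (∫ f, (n : ℝ)⁻¹ * ∑ i, fderiv ℝ (fun g => Δ g (S i)) f (v f) ∂Q)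
        - n * α ^ 2 * (∫ f, meanSqDeriv P Δ S f (v f) ∂Q)
        - lam * α ^ 2 / 2 * (∫⁻ f, dualEnergy (A f) (v f) ∂Q).toReal ≤ K := by
  have hn' : (0 : ℝ) < n := by exact_mod_cast hn
  have heM : Measurable fun f => dualEnergy (A f) (v f) := measurable_dualEnergy hA_meas hv
  have hfin : ∀ᵐ f ∂Q, dualEnergy (A f) (v f) ≠ ∞ :=
    (ae_lt_top heM hW).mono fun f hf => hf.ne
  have hei : Integrable (fun f => (dualEnergy (A f) (v f)).toReal) Q :=
    integrable_toReal_of_lintegral_ne_top heM.aemeasurable hW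
  have heint : ∫ f, (dualEnergy (A f) (v f)).toReal ∂Q
      = (∫⁻ f, dualEnergy (A f) (v f) ∂Q).toReal :=
    integral_toReal heM.aemeasurable (ae_lt_top heM hW)
  have hqm := measurable_meanSqDeriv (P := P) hm hd S hv
  have hqi : Integrable (fun f => meanSqDeriv P Δ S f (v f)) Q := by
    refine (hei.const_mul (l ^ 2)).mono' hqm.aestronglyMeasurable ?_
    filter_upwards [hfin] with f hf
    rw [Real.norm_of_nonneg (meanSqDeriv_nonneg S f _)]
    exact meanSqDeriv_le hn hl0 hl S hf
  set a : F → ℝ := fun f => (n : ℝ)⁻¹ * ∑ i, fderiv ℝ (fun g => Δ g (S i)) f (v f) with ha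
  have ham : Measurable a := (Finset.measurable_sum _ fun i _ =>
    measurable_fderiv_apply hm hd measurable_id measurable_const hv).const_mul _
  have ha2 : MemLp a 2 Q := by
    rw [memLp_two_iff_integrable_sq ham.aestronglyMeasurable]
    refine (hqi.const_mul 2).mono' (ham.pow_const 2).aestronglyMeasurable (ae_of_all _ fun f => ?_)
    rw [Real.norm_of_nonneg (sq_nonneg _)]
    exact sq_mean_fderiv_le S f _
  have hai : Integrable a Q := ha2.integrable (by norm_num)
  refine ⟨hqi, ?_, ?_, ?_⟩
  · refine (sq_integral_le_mul_integral_sq ha2).trans ?_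
    rw [probReal_univ, one_mul, ← integral_const_mul]
    exact integral_mono ha2.integrable_sq (hqi.const_mul 2) fun f => sq_mean_fderiv_le S f _
  · rw [← heint, ← integral_const_mul]
    refine integral_mono_ae hqi (hei.const_mul _) ?_
    filter_upwards [hfin] with f hf using meanSqDeriv_le hn hl0 hl S hf
  · intro K lam hmean α hα hK
    have hae : (fun f => logWeight P (fun z => fderiv ℝ (fun g => Δ g z) f) S (α • v f)
        - lam / 2 * (dualEnergy (A f) (α • v f)).toReal) =ᵐ[Q]
        fun f => n * α * a f - n * α ^ 2 * meanSqDeriv P Δ S f (v f)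
          - lam * α ^ 2 / 2 * (dualEnergy (A f) (v f)).toReal := by
      filter_upwards [hmean] with f hf
      rw [dualEnergy_smul _ _ hα, ENNReal.toReal_mul, ENNReal.toReal_ofReal (by positivity)]
      simp only [logWeight, ha, meanSqDeriv, map_smul, smul_eq_mul, mul_pow, integral_const_mul, hf,
        Finset.sum_sub_distrib, ← Finset.mul_sum, ← Finset.sum_div]
      field_simp
      ring
    have hint : Integrable (fun f => n * α * a f - n * α ^ 2 * meanSqDeriv P Δ S f (v f)
          - lam * α ^ 2 / 2 * (dualEnergy (A f) (v f)).toReal) Q :=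
      ((hai.const_mul _).sub (hqi.const_mul _)).sub (hei.const_mul _)
    have h1 := hK ((integrable_congr hae).2 hint)
    rw [integral_congr_ae hae, integral_sub (f := fun f => n * α * a f -
      n * α ^ 2 * meanSqDeriv P Δ S f (v f)) ((hai.const_mul _).sub (hqi.const_mul _))
      (hei.const_mul _), integral_sub (hai.const_mul _) (hqi.const_mul _),
      integral_const_mul (n * α) a, integral_const_mul (n * α ^ 2),
      integral_const_mul (lam * α ^ 2 / 2), heint] at h1
    exact h1

end Velocity

/-! ### The derivative of the deviation -/

namespace PosteriorFlow

variable {F Ω₀ Z : Type*} [NormedAddCommGroup F] [InnerProductSpace ℝ F] [CompleteSpace F]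
  [TopologicalSpace.SeparableSpace F] [MeasurableSpace F] [BorelSpace F] [MeasurableSpace Ω₀]
  [MeasurableSpace Z] {A : F → F →L[ℝ] F} {l : ℝ} {Δ : F → Z → ℝ} {n : ℕ}

/-- The deviation is differentiable along the flow. The last estimate of its derivative is used for
`L = 0`, where it holds with arbitrarily small `l`. -/
theorem hasDerivWithinAt_dev (ξ : PosteriorFlow F Ω₀) (hn : 0 < n) (hA : ∀ f, (A f).IsPositive)
    (hΔ : ∀ f, Measurable (Δ f)) (hd : ∀ z, Differentiable ℝ fun f => Δ f z) (hl0 : 0 < l)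
    (hl : ∀ f z u, fderiv ℝ (fun g => Δ g z) f (A f u) ^ 2 ≤ l ^ 2 * ⟪u, A f u⟫) (S : Fin n → Z)
    {t : ℝ} (ht : 0 ≤ t) (hE : ξ.EnergyBoundedNear A t)
    (hint : Integrable (fun f => ∫ z, Δ f z ∂(empirical S)) (ξ.law t)) :
    MemLp (fun x => fderiv ℝ (fun f => ∫ z, Δ f z ∂(empirical S)) (ξ.sol t x) (ξ.velocity t x)) 2
      ξ.base ∧
    HasDerivWithinAt (ξ.dev Δ S)
      (∫ x, fderiv ℝ (fun f => ∫ z, Δ f z ∂(empirical S)) (ξ.sol t x) (ξ.velocity t x) ∂ξ.base)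
      (Ici 0) t ∧
    ENNReal.ofReal ((∫ x, fderiv ℝ (fun f => ∫ z, Δ f z ∂(empirical S)) (ξ.sol t x)
      (ξ.velocity t x) ∂ξ.base) ^ 2) ≤
      ENNReal.ofReal (l ^ 2) * ∫⁻ x, localNorm (A (ξ.sol t x)) (ξ.velocity t x) ^ 2 ∂ξ.base := by
  have hΨ : ∀ f u, fderiv ℝ (fun f => ∫ z, Δ f z ∂(empirical S)) f (A f u) ^ 2 ≤
      l ^ 2 * ⟪u, A f u⟫ := by
    intro f u
    rw [fderiv_integral_empirical_apply hΔ hd S f]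
    exact (sq_mean_le _).trans (mean_le hn fun i => hl f (S i) u)
  obtain ⟨h1, h2⟩ := ξ.hasDerivWithinAt_integral_law hA
    (fun f => (hasFDerivAt_integral_empirical hΔ hd S f).differentiableAt) hl0 hΨ ht hE hint
  refine ⟨h1, h2, ?_⟩
  refine le_trans ?_ (ξ.lintegral_sq_fderiv_velocity_le hA hl0 hΨ t)
  refine le_trans (ENNReal.ofReal_le_ofReal ?_) (ofReal_integral_le_lintegral h1.integrable_sq)
  simpa using sq_integral_le_mul_integral_sq h1

/-- Only the mean flow enters the derivative of the deviation, although the random velocity drives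
the solution. -/
theorem integral_fderiv_velocity_eq (ξ : PosteriorFlow F Ω₀) {μ : ℝ → F → F} (hμ : ξ.IsMeanFlow μ)
    (hm : Measurable (Function.uncurry Δ)) (hd : ∀ z, Differentiable ℝ fun f => Δ f z)
    (S : Fin n → Z) {t : ℝ} (ht : 0 ≤ t)
    (hint : Integrable (fun x => fderiv ℝ (fun f => ∫ z, Δ f z ∂(empirical S)) (ξ.sol t x)
      (ξ.velocity t x)) ξ.base) :
    ∫ x, fderiv ℝ (fun f => ∫ z, Δ f z ∂(empirical S)) (ξ.sol t x) (ξ.velocity t x) ∂ξ.base =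
      ∫ f, (n : ℝ)⁻¹ * ∑ i, fderiv ℝ (fun g => Δ g (S i)) f (μ t f) ∂(ξ.law t) := by
  have hΔ : ∀ f, Measurable (Δ f) := fun f => hm.of_uncurry_left
  simp_rw [← inner_gradient_left] at hint ⊢
  rw [(ξ.integral_inner_velocity hμ ht (measurable_gradient _) hint).2]
  have hmeas : Measurable fun f => (n : ℝ)⁻¹ * ∑ i, ⟪gradient (fun g => Δ g (S i)) f, μ t f⟫ := by
    simp_rw [inner_gradient_left]
    exact (Finset.measurable_sum _ fun i _ =>
      measurable_fderiv_apply hm hd measurable_id measurable_const (hμ t ht).1).const_mul _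
  rw [law, integral_map (ξ.measurable_sol t ht).aemeasurable hmeas.aestronglyMeasurable]
  refine integral_congr_ae (ae_of_all _ fun x => ?_)
  simp only [inner_gradient_left]
  exact fderiv_integral_empirical_apply hΔ hd S _ _

end PosteriorFlow

/-- The grid inequalities give the bound with values in `[0, ∞]`. The complexity `H` may be infinite:
then the right-hand side is infinite, unless `V2 = 0`, which forces `d = 0`. -/
theorem ofReal_le_velocity_bound {n : ℕ} (hn : 0 < n) {L : ℝ≥0} (hL : 0 < L) {d V2 W2 : ℝ}
    {V W H : ℝ≥0∞} {c : ℝ} (hc : 1 ≤ c) (hV0 : 0 ≤ V2) (hW0 : 0 ≤ W2)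
    (hV : ENNReal.ofReal V2 ≤ V) (hW : ENNReal.ofReal W2 ≤ W)
    (hVW : V2 ≤ L ^ 2 * W2) (hdV : d ^ 2 ≤ 2 * V2)
    (h : H ≠ ∞ → ∀ k : Fin (Nat.log 4 n + 1), ∀ α : ℝ, 0 < α →
      n * α * d - n * α ^ 2 * V2 - (3 / 4 * (n * (L : ℝ) ^ 2) / 4 ^ (k : ℕ)) * α ^ 2 / 2 * W2 ≤
        H.toReal + c + n * (L : ℝ) ^ 2 / (3 / 4 * (n * (L : ℝ) ^ 2) / 4 ^ (k : ℕ))) :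
    ENNReal.ofReal d ≤ 2 * V ^ (1 / 2 : ℝ) *
        ((H + ENNReal.ofReal c) / (n : ℝ≥0∞)) ^ (1 / 2 : ℝ)
      + 2 * (L : ℝ≥0∞) * W ^ (1 / 2 : ℝ) / (n : ℝ≥0∞) ^ (1 / 2 : ℝ) := by
  have hn' : (0 : ℝ) < n := by exact_mod_cast hn
  have hroot : ∀ {x : ℝ} {y : ℝ≥0∞}, 0 ≤ x → ENNReal.ofReal x ≤ y →
      ENNReal.ofReal (√x) ≤ y ^ (1 / 2 : ℝ) := by
    intro x y hx hxy
    rw [Real.sqrt_eq_rpow, ← ENNReal.ofReal_rpow_of_nonneg hx (by norm_num)]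
    exact ENNReal.rpow_le_rpow hxy (by norm_num)
  rcases hV0.eq_or_lt with hV2 | hV2
  · have : d = 0 := by
      rw [← hV2, mul_zero] at hdV
      exact pow_eq_zero_iff two_ne_zero |>.1 (le_antisymm hdV (sq_nonneg _))
    simp [this]
  have hVpos : V ^ (1 / 2 : ℝ) ≠ 0 := by
    have := (ENNReal.ofReal_pos.2 (Real.sqrt_pos.2 hV2)).trans_le (hroot hV0 hV)
    exact this.ne'
  by_cases hH : H = ∞
  · have : (2 * V ^ (1 / 2 : ℝ) * ((H + ENNReal.ofReal c) / (n : ℝ≥0∞)) ^ (1 / 2 : ℝ)) = ∞ := by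
      rw [hH, top_add, ENNReal.top_div_of_ne_top (ENNReal.natCast_ne_top n),
        ENNReal.top_rpow_of_pos (by norm_num)]
      exact ENNReal.mul_top (mul_ne_zero two_ne_zero hVpos)
    rw [this, top_add]
    exact le_top
  have hK : 1 ≤ H.toReal + c := by linarith [ENNReal.toReal_nonneg (a := H)]
  have key : d ≤ 2 * √V2 * √((H.toReal + c) / n) + 2 * L * √W2 / √n := by
    refine le_of_forall_grid_le hn (by exact_mod_cast hL) (Real.sqrt_pos.2 hV2) (Real.sqrt_nonneg _)
      ?_ ?_ hK ?_
    · rw [← Real.sqrt_sq (NNReal.coe_nonneg L), ← Real.sqrt_mul (sq_nonneg _)]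
      exact Real.sqrt_le_sqrt hVW
    · rwa [Real.sq_sqrt hV0]
    · intro k α hα
      rw [Real.sq_sqrt hV0, Real.sq_sqrt hW0]
      exact h hH k α hα
  have hHc : ENNReal.ofReal ((H.toReal + c) / n) ≤ (H + ENNReal.ofReal c) / n := by
    rw [ENNReal.ofReal_div_of_pos hn', ENNReal.ofReal_add ENNReal.toReal_nonneg (by linarith),
      ENNReal.ofReal_toReal hH, ENNReal.ofReal_natCast]
  have hsn : ENNReal.ofReal (√n) = (n : ℝ≥0∞) ^ (1 / 2 : ℝ) := by
    rw [Real.sqrt_eq_rpow, ← ENNReal.ofReal_rpow_of_nonneg hn'.le (by norm_num),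
      ENNReal.ofReal_natCast]
  refine (ENNReal.ofReal_le_ofReal key).trans ?_
  rw [ENNReal.ofReal_add (by positivity) (by positivity), ENNReal.ofReal_mul (by positivity),
    ENNReal.ofReal_mul (by norm_num), ENNReal.ofReal_div_of_pos (Real.sqrt_pos.2 hn'),
    ENNReal.ofReal_mul (by positivity), ENNReal.ofReal_mul (by norm_num), hsn,
    ENNReal.ofReal_coe_nnreal, ENNReal.ofReal_ofNat]
  gcongr
  · exact hroot hV0 hV
  · exact hroot (by positivity) hHc
  · exact hroot hW0 hW

end Transport

theorem theorem1
    {F Z : Type*} [NormedAddCommGroup F] [InnerProductSpace ℝ F] [CompleteSpace F]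
    [TopologicalSpace.SeparableSpace F] [MeasurableSpace F] [BorelSpace F] [MeasurableSpace Z]
    -- the data distribution and the sample size
    (P : Measure Z) [IsProbabilityMeasure P] (n : ℕ) (hn : 0 < n)
    -- the loss, differentiable in the predictor, with finite and differentiable risk
    (ℓ : F → Z → ℝ) (hℓ_meas : Measurable (Function.uncurry ℓ))
    (hℓ_diff : ∀ z, Differentiable ℝ (fun f => ℓ f z))
    (hℓ_int : ∀ f, Integrable (ℓ f) P)
    (hr_diff : Differentiable ℝ (Transport.risk P ℓ))
    -- the inverse metric field
    (A : F → F →L[ℝ] F) (hA_pos : ∀ f, (A f).IsPositive)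
    (hA_meas : ∀ u, Measurable (fun f => A f u))
    -- the deviation function is Lipschitz with respect to the metric field
    (L : ℝ≥0) (hL : Transport.IsLipschitz A (Transport.deviation P ℓ) L)
    -- the prior and the confidence level
    (U : Measure F) [IsProbabilityMeasure U] (δ : ℝ) (hδ0 : 0 < δ) (hδ1 : δ < 1) :
    ∃ E : Set (Fin n → Z), MeasurableSet E ∧
      ENNReal.ofReal (1 - δ) ≤ Measure.pi (fun _ : Fin n => P) E ∧
      ∀ S ∈ E, ∀ (Ω₀ : Type*) [MeasurableSpace Ω₀] (ξ : Transport.PosteriorFlow F Ω₀)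
        (μ : ℝ → F → F), ξ.IsMeanFlow μ → ∀ t : ℝ, 0 ≤ t →
        ξ.EnergyBoundedNear A t →
        Integrable (fun f => ∫ z, Transport.deviation P ℓ f z ∂(Transport.empirical S)) (ξ.law t) →
        ∃ d : ℝ,
          HasDerivWithinAt (ξ.dev (Transport.deviation P ℓ) S) d (Ici 0) t ∧
          (d : EReal) ≤
            ((2 * Transport.deviationVelocity P (Transport.deviation P ℓ) S (ξ.law t) (μ t)
                * ((Transport.complexity δ (ξ.law t) U + ENNReal.ofReal (Transport.logFactor n))
                    / (n : ℝ≥0∞)) ^ (1 / 2 : ℝ)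
              + 2 * (L : ℝ≥0∞) * Transport.wassersteinVelocity A (ξ.law t) (μ t)
                / (n : ℝ≥0∞) ^ (1 / 2 : ℝ) : ℝ≥0∞) : EReal) := by
  have := UniformSpace.secondCountable_of_separable F
  set Δ := Transport.deviation P ℓ with hΔdef
  have hm : Measurable (Function.uncurry Δ) :=
    (hr_diff.continuous.measurable.comp measurable_fst).sub hℓ_meas
  have hΔ : ∀ f, Measurable (Δ f) := fun f => hm.of_uncurry_left
  have hd : ∀ z, Differentiable ℝ fun f => Δ f z := fun z => hr_diff.sub (hℓ_diff z)
  have hlip := hL.sq_fderiv_le hA_pos hd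
  rcases (zero_le (a := L)).eq_or_lt with hL0 | hL0
  · -- For `L = 0` the bound holds with every positive constant, so the deviation is stationary.
    refine ⟨univ, MeasurableSet.univ, ?_, fun S _ Ω₀ _ ξ μ hμ t ht hE hint => ?_⟩
    · rw [measure_univ]
      exact ENNReal.ofReal_le_one.2 (by linarith)
    have hl : ∀ l : ℝ, ∀ f z u,
        fderiv ℝ (fun g => Δ g z) f (A f u) ^ 2 ≤ l ^ 2 * ⟪u, A f u⟫ := fun l f z u => by
      refine (hlip f z u).trans ?_
      have := Transport.inner_map_nonneg (hA_pos f) u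
      rw [← hL0]
      simp only [NNReal.coe_zero]
      nlinarith [mul_nonneg (sq_nonneg l) this]
    refine ⟨_, (ξ.hasDerivWithinAt_dev hn hA_pos hΔ hd one_pos (hl 1) S ht hE hint).2.1, ?_⟩
    set d := ∫ x, fderiv ℝ (fun f => ∫ z, Δ f z ∂(Transport.empirical S)) (ξ.sol t x)
      (ξ.velocity t x) ∂ξ.base with hddef
    obtain ⟨C, hC⟩ := hE
    have hCt := hC.self_of_nhdsWithin ht
    have hdl : ∀ l : ℝ, 0 < l → d ^ 2 ≤ l ^ 2 * C := fun l hl0 => by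
      have h := (ξ.hasDerivWithinAt_dev hn hA_pos hΔ hd hl0 (hl l) S ht ⟨C, hC⟩ hint).2.2
      have h2 := h.trans (mul_le_mul_right hCt _)
      rw [← ENNReal.ofReal_coe_nnreal, ← ENNReal.ofReal_mul (sq_nonneg l)] at h2
      exact (ENNReal.ofReal_le_ofReal_iff (by positivity)).1 h2
    have hd0 : d ^ 2 ≤ 0 := by
      have hlim : Tendsto (fun l : ℝ => l ^ 2 * C) (𝓝[>] 0) (𝓝 (0 ^ 2 * C)) :=
        ((continuous_id.pow 2).mul continuous_const).continuousAt.tendsto.mono_left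
          nhdsWithin_le_nhds
      have := ge_of_tendsto hlim (eventually_mem_nhdsWithin.mono hdl)
      simpa using this
    have hd0' : d = 0 := pow_eq_zero_iff two_ne_zero |>.1 (le_antisymm hd0 (sq_nonneg _))
    rw [hd0', EReal.coe_zero]
    exact EReal.coe_ennreal_nonneg _
  · have hl0 : (0 : ℝ) < L := by exact_mod_cast hL0
    have hn' : (0 : ℝ) < n := by exact_mod_cast hn
    obtain ⟨E, hEm, hEδ, hE⟩ := Transport.exists_event_integral_logWeight_le P n hA_pos hA_meas
      (X := fun f z => fderiv ℝ (fun g => Δ g z) f)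
      (fun v hv => Transport.measurable_fderiv_apply hm hd measurable_fst measurable_snd
        (hv.comp measurable_fst))
      hl0 hlip U hδ0 (Nat.succ_pos (Nat.log 4 n))
      (lam := fun k => 3 / 4 * (n * (L : ℝ) ^ 2) / 4 ^ (k : ℕ)) (fun k => by positivity)
    refine ⟨E, hEm, hEδ, fun S hS Ω₀ _ ξ μ hμ t ht hEn hint => ?_⟩
    obtain ⟨hmem, hder, -⟩ := ξ.hasDerivWithinAt_dev hn hA_pos hΔ hd hl0 hlip S ht hEn hint
    refine ⟨_, hder, ?_⟩
    rw [ξ.integral_fderiv_velocity_eq hμ hm hd S ht (hmem.integrable (by norm_num))]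
    have := ξ.isProbabilityMeasure_law ht
    have hμm := (hμ t ht).1
    have hWle : ∫⁻ f, Transport.dualEnergy (A f) (μ t f) ∂(ξ.law t) ≤
        ∫⁻ f, Transport.localNorm (A f) (μ t f) ^ 2 ∂(ξ.law t) :=
      lintegral_mono fun f => Transport.dualEnergy_le_localNorm_sq (hA_pos f) _
    -- infinite energy makes the last term of the bound infinite
    by_cases hW : ∫⁻ f, Transport.dualEnergy (A f) (μ t f) ∂(ξ.law t) = ∞
    · rw [hW, top_le_iff] at hWle
      have htop : 2 * (L : ℝ≥0∞) * Transport.wassersteinVelocity A (ξ.law t) (μ t)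
          / (n : ℝ≥0∞) ^ (1 / 2 : ℝ) = ∞ := by
        rw [Transport.wassersteinVelocity, hWle, ENNReal.top_rpow_of_pos (by norm_num),
          ENNReal.mul_top (mul_ne_zero two_ne_zero (by exact_mod_cast hL0.ne')),
          ENNReal.top_div_of_ne_top
            (ENNReal.rpow_ne_top_of_nonneg (by norm_num) (ENNReal.natCast_ne_top n))]
      rw [htop, add_top, EReal.coe_ennreal_top]
      exact le_top
    obtain ⟨hqi, hsq, hVW, hgrid⟩ := Transport.integral_mean_fderiv_le hn hm hd hA_meas hl0 hlip S
      (P := P) hμm hW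
    have hmean := ξ.ae_integral_fderiv_meanFlow_eq_zero hA_pos hm hd
      (Transport.integral_deviation hℓ_int) (Transport.integrable_deviation hℓ_int) hl0 hlip hμ ht
      hEn hW
    have hfin : ∀ᵐ f ∂(ξ.law t), Transport.dualEnergy (A f) (μ t f) ≠ ∞ :=
      (ae_lt_top (Transport.measurable_dualEnergy hA_meas hμm) hW).mono fun f hf => hf.ne
    have hlogδ : 0 ≤ Real.log (1 / δ) := Real.log_nonneg (one_le_one_div hδ0 hδ1.le)
    have hlogn := Transport.one_le_logFactor n
    have hV : ENNReal.ofReal (∫ f, Transport.meanSqDeriv P Δ S f (μ t f) ∂(ξ.law t)) ≤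
        ∫⁻ f, ∫⁻ z, ENNReal.ofReal (⟪μ t f, gradient (fun g => Δ g z) f⟫ ^ 2)
          ∂((2 : ℝ≥0∞)⁻¹ • (P + Transport.empirical S)) ∂(ξ.law t) :=
      (Transport.ofReal_integral_le_lintegral hqi).trans (lintegral_mono_ae
        (hfin.mono fun f hf => Transport.ofReal_meanSqDeriv_le_lintegral hn hm hd hl0 hlip S hf))
    have hmain := Transport.ofReal_le_velocity_bound hn hL0
      (H := InformationTheory.klDiv (ξ.law t) U)
      (c := Real.log (1 / δ) + Transport.logFactor n) (by linarith)
      (integral_nonneg fun f => Transport.meanSqDeriv_nonneg S f _) ENNReal.toReal_nonneg hV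
      ((ENNReal.ofReal_toReal hW).le.trans hWle) hVW hsq (fun hH k α hα => by
        obtain ⟨hac, hllr⟩ := InformationTheory.klDiv_ne_top_iff.1 hH
        refine hgrid _ _ hmean α hα fun hi => ?_
        have hαfin : ∀ᵐ f ∂(ξ.law t), Transport.dualEnergy (A f) (α • μ t f) ≠ ∞ := by
          filter_upwards [hfin] with f hf
          rw [Transport.dualEnergy_smul _ _ hα]
          exact ENNReal.mul_ne_top ENNReal.ofReal_ne_top hf
        refine (hE S hS (ξ.law t) hac hllr (fun f => α • μ t f) k hαfin hi).trans ?_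
        have := Transport.log_le_logFactor hn
        linarith)
    rw [ENNReal.ofReal_add hlogδ (by linarith), ← add_assoc] at hmain
    refine le_trans ?_ (EReal.coe_ennreal_le_coe_ennreal_iff.2 hmain)
    rw [EReal.coe_ennreal_ofReal]
    exact EReal.coe_le_coe_iff.2 (le_max_left _ _)
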